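/- **Model.** A low-space MPC algorithm with local memory exponent $\delta\in(0,1)$, for graphs with node set $\{0,\dots,n-1\}$, consists of polynomially many machines ($n^k$ machines, $k\ge 1$ a constant, so polynomial global memory is allowed), each with a memory of $O(n^\delta)$ words of $O(\log n)$ bits. The nodes of the input graph, each together with its incident labeled half-edges, are distributed arbitrarily among the machines, subject to the local memory. In every synchronous round each machine performs arbitrary local computations and exchanges messages with all other machines, sending and receiving at most $O(n^\delta)$ words. Machines may use (shared) randomness; an algorithm runs in $o(f(n))$ rounds if for every constant $c$ it can be run in $o(f(n))$ rounds so that, on every admissible input with $n$ nodes, $n$ large, it respects the memory bounds and is correct with probability at least $1-n^{-c}$. Deterministic algorithms are a special case. At the end, the machine that holds a node knows the output at this node; for decision problems every machine knows the answer. **1 vs. 2 cycles conjecture.** For no $\delta\in(0,1)$ is there a low-space MPC algorithm with polynomial global memory that decides in $o(\log n)$ rounds whether an $n$-node graph, promised to be either one cycle on $n$ nodes or two disjoint cycles on $n/2$ nodes each, is a single cycle. **LCLs.** A (node-edge-checkable) LCL problem $\Pi=(\Sigma_{\mathrm{in}},\Sigma_{\mathrm{out}},C_V,C_E)$ on graphs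 of maximum degree at most a constant $\Delta$ is given by finite sets $\Sigma_{\mathrm{in}},\Sigma_{\mathrm{out}}$ of labels and by sets $C_V$ and $C_E$ of multisets of pairs in $\Sigma_{\mathrm{in}}\times\Sigma_{\mathrm{out}}$, those in $C_E$ having size $2$. Every half-edge $(v,e)$, $v\in e$, carries an input label and has to be given an output label so that, for each node $v$, the multiset of the label pairs on the half-edges at $v$ is in $C_V$ and, for each edge, the multiset of the label pairs on its two half-edges is in $C_E$. $\Pi$ is *solvable* (on forests) if it has a solution on every forest of maximum degree at most $\Delta$ with every input labeling. **Theorem.** Assume the 1 vs. 2 cycles conjecture. Then: 1. For all $\delta\in(0,1)$ and all $D=D(n)$ with $D\in\Omega(\log n)$ and $D\in n^{o(1)}$, it is not the case that every solvable LCL can be solved by a low-space MPC algorithm with local memory $O(n^\delta)$ in $o(\log D)$ rounds on the $n$-node forests whose components have diameter at most $D$, even if polynomial global memory is allowed. 2. For every constant $\Delta\ge 2$ this is witnessed, for all such $\delta$ and $D$ simultaneously, by the following path-orientation LCL $\Pi$ on graphs of maximum degree at most $\Delta$. Half-edges have inputs $0$ or $1$ (the input of the node); every edge is to be either oriented or left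 unoriented, such that: at a node of degree $2$ either both edges are unoriented, or one is incoming and the other outgoing; the edge at a node of degree $1$ with input $1$ is oriented; the edge at a node of degree $1$ with input $0$ is unoriented or incoming. That is: * $\Pi$ is solvable on forests; * there is no low-space MPC algorithm that solves $\Pi$ in $o(\log D)$ rounds on the $n$-node forests of maximum degree at most $\Delta$ whose components have diameter at most $D$; * if $G$ is a disjoint union of paths, $s\neq t$ are nodes of degree $1$, and $s$ has input $1$ while all other nodes have input $0$, then in every solution of $\Pi$ the edge at $t$ is oriented if and only if $s$ and $t$ lie on the same path (so that a solution reveals this at $t$, without further communication). -/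

import Mathlib

open Filter Asymptotics

/-! ### Half-edge labelings and locally checkable labelings -/

/-- A half-edge `(v, {v, u})` of `G` is the dart from `v` to `u`. -/
abbrev HalfEdgeLabeling {V : Type} (G : SimpleGraph V) (L : Type) : Type := G.Dart → L

/-- A node-edge-checkable LCL problem on graphs of maximum degree at most `maxDegree`.
Only multisets of size at most `maxDegree` over a finite alphabet matter in `nodeConfigs`,
so the problem has a finite description. -/
structure LCL where
  In : Type
  Out : Type
  finite_in : Finite In
  finite_out : Finite Out
  maxDegree : ℕ
  nodeConfigs : Set (Multiset (In × Out))
  edgeConfigs : Set (Sym2 (In × Out))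

/-- The multiset of pairs (input label, output label) on the half-edges incident to `v`. -/
noncomputable def nodeMultiset {V : Type} [Fintype V] {G : SimpleGraph V} {I O : Type}
    (gin : HalfEdgeLabeling G I) (gout : HalfEdgeLabeling G O) (v : V) : Multiset (I × O) :=
  letI : DecidablePred (fun d : G.Dart => d.fst = v) := Classical.decPred _
  letI : DecidableRel G.Adj := Classical.decRel _
  (Finset.univ.filter (fun d : G.Dart => d.fst = v)).val.map (fun d => (gin d, gout d))

/-- The output labeling `gout` solves the LCL on `G` with input labeling `gin`. -/
def LCL.IsSolution (P : LCL) {V : Type} [Fintype V] {G : SimpleGraph V}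
    (gin : HalfEdgeLabeling G P.In) (gout : HalfEdgeLabeling G P.Out) : Prop :=
  (∀ v : V, nodeMultiset gin gout v ∈ P.nodeConfigs) ∧
    ∀ d : G.Dart, s((gin d, gout d), (gin d.symm, gout d.symm)) ∈ P.edgeConfigs

/-- `G` has maximum degree at most `k`. -/
def MaxDegreeLE {V : Type} (G : SimpleGraph V) (k : ℕ) : Prop :=
  ∀ v : V, (G.neighborSet v).ncard ≤ k

/-- Every connected component of `G` has diameter at most `D`. -/
def ComponentDiamLE {V : Type} (G : SimpleGraph V) (D : ℕ) : Prop :=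
  ∀ u v : V, G.Reachable u v → G.dist u v ≤ D

/-- The LCL is solvable on forests: every input-labeled forest (of the degree for which the
problem is defined) admits a solution. -/
def LCL.SolvableOnForests (P : LCL) : Prop :=
  ∀ (n : ℕ) (G : SimpleGraph (Fin n)), G.IsAcyclic → MaxDegreeLE G P.maxDegree →
    ∀ gin : HalfEdgeLabeling G P.In, ∃ gout : HalfEdgeLabeling G P.Out, P.IsSolution gin gout

/-! ### The path-orientation problem -/

/-- The status of an edge, seen from one of its endpoints. -/
inductive EdgeStatus : Type
  | unoriented
  | outgoing
  | incoming

instance EdgeStatus.finite : Finite EdgeStatus :=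
  Finite.of_surjective
    (fun b : Option Bool => match b with
      | none => EdgeStatus.unoriented
      | some true => EdgeStatus.outgoing
      | some false => EdgeStatus.incoming)
    (fun e => by
      cases e
      · exact ⟨none, rfl⟩
      · exact ⟨some true, rfl⟩
      · exact ⟨some false, rfl⟩)

/-- The path-orientation LCL. The input of a node is `0` (`false`) or `1` (`true`), written on its
half-edges. Every edge is unoriented or oriented; a node of degree 2 has both edges unoriented, or
one incoming and one outgoing edge; the edge at a node of degree 1 with input 1 is oriented; the
edge at a node of degree 1 with input 0 is unoriented or incoming. -/
def pathOrientation (maxDeg : ℕ) : LCL where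
  In := Bool
  Out := EdgeStatus
  finite_in := inferInstance
  finite_out := inferInstance
  maxDegree := maxDeg
  nodeConfigs := {m | m.card ≤ maxDeg ∧
    (m.card = 1 → ∀ x ∈ m, (x.1 = true → x.2 ≠ EdgeStatus.unoriented) ∧
      (x.1 = false → x.2 ≠ EdgeStatus.outgoing)) ∧
    (m.card = 2 → m.map Prod.snd = {EdgeStatus.unoriented, EdgeStatus.unoriented} ∨
      m.map Prod.snd = {EdgeStatus.incoming, EdgeStatus.outgoing})}
  edgeConfigs := {e | e.map Prod.snd = s(EdgeStatus.unoriented, EdgeStatus.unoriented) ∨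
    e.map Prod.snd = s(EdgeStatus.outgoing, EdgeStatus.incoming)}

/-! ### The MPC model -/

/-- What a machine holds initially: the identifiers of its nodes, and for each half-edge
`(v, {v, u})` at one of its nodes the triple (`v`, `u`, input label). -/
structure LocalInput (n : ℕ) (I : Type) where
  nodes : Set (Fin n)
  halfEdges : Set (Fin n × Fin n × I)

/-- The number of words of a local input. -/
noncomputable def LocalInput.size {n : ℕ} {I : Type} (x : LocalInput n I) : ℕ :=
  x.nodes.ncard + 3 * x.halfEdges.ncard

/-- The input of machine `i` when each node `v` is held by machine `host v`. -/
def localInput {n M : ℕ} {I : Type} {G : SimpleGraph (Fin n)} (gin : HalfEdgeLabeling G I)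
    (host : Fin n → Fin M) (i : Fin M) : LocalInput n I where
  nodes := {v | host v = i}
  halfEdges := {x | ∃ d : G.Dart, host d.fst = i ∧ x = (d.fst, d.snd, gin d)}

/-- An MPC program for graphs with node identifiers `0, …, n - 1` and `M` machines, with words in
`{0, …, M - 1}`. A machine's memory is a list of words. All local computations are arbitrary
functions, which may also use a random seed, drawn uniformly from a finite set; a deterministic
program is one with a single seed. In round `r`, machine `i` sends the list `send ω r i mem j` of
words to machine `j`; then every machine computes its new memory from its old memory and the
messages that it received from each machine. At the end, each machine computes a result. -/
structure MPCProgram (n M : ℕ) (I Res : Type) where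
  Seed : Type
  finite_seed : Finite Seed
  nonempty_seed : Nonempty Seed
  load : Seed → Fin M → LocalInput n I → List (Fin M)
  send : Seed → ℕ → Fin M → List (Fin M) → Fin M → List (Fin M)
  update : Seed → ℕ → Fin M → List (Fin M) → (Fin M → List (Fin M)) → List (Fin M)
  output : Seed → Fin M → List (Fin M) → Res

namespace MPCProgram

variable {n M : ℕ} {I Res : Type}

/-- The memories of all machines after `r` rounds, on the local inputs `x`. -/
def memory (A : MPCProgram n M I Res) (ω : A.Seed) (x : Fin M → LocalInput n I) :
    ℕ → Fin M → List (Fin M)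
  | 0 => fun i => A.load ω i (x i)
  | r + 1 => fun j => A.update ω r j (A.memory ω x r j)
      (fun i => A.send ω r i (A.memory ω x r i) j)

/-- In an execution of `T` rounds, no machine ever stores more than `S` words, or sends or
receives more than `S` words in a round. -/
def WithinBudget (A : MPCProgram n M I Res) (ω : A.Seed) (x : Fin M → LocalInput n I)
    (T : ℕ) (S : ℝ) : Prop :=
  (∀ r ≤ T, ∀ i, ((A.memory ω x r i).length : ℝ) ≤ S) ∧
  (∀ r < T, ∀ i, ((∑ j, (A.send ω r i (A.memory ω x r i) j).length : ℕ) : ℝ) ≤ S) ∧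
  (∀ r < T, ∀ j, ((∑ i, (A.send ω r i (A.memory ω x r i) j).length : ℕ) : ℝ) ≤ S)

/-- The results of all machines after `T` rounds. -/
def result (A : MPCProgram n M I Res) (ω : A.Seed) (x : Fin M → LocalInput n I) (T : ℕ) :
    Fin M → Res :=
  fun i => A.output ω i (A.memory ω x T i)

/-- The probability that an execution of `T` rounds respects the budget of `S` words per machine
and ends with results that satisfy `ok`. -/
noncomputable def successProb (A : MPCProgram n M I Res) (x : Fin M → LocalInput n I)
    (T : ℕ) (S : ℝ) (ok : (Fin M → Res) → Prop) : ℝ :=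
  (Nat.card {ω : A.Seed // A.WithinBudget ω x T S ∧ ok (A.result ω x T)} : ℝ) / Nat.card A.Seed

end MPCProgram

/-- A (promise) problem on graphs with labeled half-edges: the inputs on which it has to be solved,
and the correct results of the machines, which may depend on the machine `host v` that holds
each node `v`. -/
structure MPCProblem where
  In : Type
  Res : ℕ → Type
  IsInstance : ∀ {n : ℕ} (G : SimpleGraph (Fin n)), HalfEdgeLabeling G In → Prop
  IsCorrect : ∀ {n M : ℕ} (G : SimpleGraph (Fin n)), HalfEdgeLabeling G In →
    (Fin n → Fin M) → (Fin M → Res n) → Prop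

/-- The problem has a low-space MPC algorithm that runs in `o(f)` rounds and succeeds with high
probability, that is, with probability at least `1 - n ^ (-c)`, where the constant `c` is arbitrary.
There are `n ^ k` machines (polynomial global memory), each with `O(n ^ δ)` words of `O(log n)` bits.
The algorithm has to work for all large `n` and for every distribution of the nodes (with their
half-edges) among the machines that respects the local memory. -/
def MPCProblem.LowSpaceSolvable (P : MPCProblem) (δ : ℝ) (f : ℕ → ℝ) : Prop :=
  ∀ c : ℕ, ∃ k : ℕ, 1 ≤ k ∧ ∃ C : ℝ, 0 < C ∧ ∃ T : ℕ → ℕ, (fun n => (T n : ℝ)) =o[atTop] f ∧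
    ∃ A : ∀ n : ℕ, MPCProgram n (n ^ k) P.In (P.Res n),
      ∀ᶠ n : ℕ in atTop, ∀ (G : SimpleGraph (Fin n)) (gin : HalfEdgeLabeling G P.In),
        P.IsInstance G gin → ∀ host : Fin n → Fin (n ^ k),
          (∀ i, ((localInput gin host i).size : ℝ) ≤ C * (n : ℝ) ^ δ) →
          1 - 1 / (n : ℝ) ^ c ≤
            (A n).successProb (localInput gin host) (T n) (C * (n : ℝ) ^ δ)
              (P.IsCorrect G gin host)

/-! ### The 1 vs. 2 cycles conjecture -/

/-- `G` is a cycle on its `n` nodes. -/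
def IsOneCycle {n : ℕ} (G : SimpleGraph (Fin n)) : Prop :=
  3 ≤ n ∧ Nonempty (G ≃g SimpleGraph.cycleGraph n)

/-- `G` consists of two disjoint cycles with `n / 2` nodes each. -/
def IsTwoCycles {n : ℕ} (G : SimpleGraph (Fin n)) : Prop :=
  ∃ m : ℕ, 3 ≤ m ∧ n = 2 * m ∧
    Nonempty (G ≃g (SimpleGraph.cycleGraph m ⊕g SimpleGraph.cycleGraph m))

/-- Tell whether the input graph is one cycle or two cycles: every machine has to answer. -/
def oneVsTwoCycles : MPCProblem where
  In := Unit
  Res := fun _ => Prop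
  IsInstance := fun G _ => IsOneCycle G ∨ IsTwoCycles G
  IsCorrect := fun G _ _ res => ∀ i, (res i ↔ IsOneCycle G)

/-- The 1 vs. 2 cycles conjecture: no low-space MPC algorithm with polynomial global memory
distinguishes one cycle on `n` nodes from two cycles on `n / 2` nodes in `o(log n)` rounds. -/
def OneVsTwoCyclesConjecture : Prop :=
  ∀ δ : ℝ, 0 < δ → δ < 1 → ¬ oneVsTwoCycles.LowSpaceSolvable δ (fun n => Real.log n)

/-! ### Solving an LCL on forests in the MPC model -/

/-- Solve the LCL `P` on forests with `n` nodes whose components have diameter at most `D n`. The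
machine that holds a node outputs the labels of the half-edges at that node. -/
def LCL.onForests (P : LCL) (D : ℕ → ℕ) : MPCProblem where
  In := P.In
  Res := fun n => Fin n → Fin n → P.Out
  IsInstance := fun {n} G _ =>
    G.IsAcyclic ∧ MaxDegreeLE G P.maxDegree ∧ ComponentDiamLE G (D n)
  IsCorrect := fun _ gin host res =>
    P.IsSolution gin (fun d => res (host d.fst) d.fst d.snd)

/-!
The second part of the theorem implies the first one, for `maxDeg = 2`.

The path-orientation problem is solvable on forests: a tree with a node of degree at least three,
or with a leaf of input 1, can be oriented away from this node, and in any other tree all edges can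
stay unoriented (`pathOrientation_solvableOnForests`). On disjoint unions of paths, orientedness
propagates along paths, and a path that is oriented towards a leaf of input 0 has to start at a leaf
of input 1; this gives `pathOrientation_reveals`.

For the hardness, a fast algorithm for path orientations on forests of diameter at most `D` is
turned into an algorithm that distinguishes one cycle from two in `o(log n)` rounds
(`oneVsTwoCycles_lowSpaceSolvable`). Let `f` be the permutation of the `2 * n` darts of the input
graph that continues each dart by the next one on its cycle (`nextDart`). A dart is fixed by
`f ^ (n / 2)` if there are two cycles, but not if there is a single one. The power `f ^ (n / 2)` is
computed by reading the exponent in base `l`, where `l` is about `D / 2`: a phase passes from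
`h = f ^ e` to `f ^ a * h ^ l`, where `a < l` is the next digit. To do this, consider the layered
graph with a node `(y, i)` for every dart `y` and every `i ≤ 2 * l`, in which `(y, i)` is adjacent to
`(π i y, i + 1)`, where `π i` is `h` in the first `l` layers, then `f` in `a` layers, and then the
identity. It is a disjoint union of paths of length `2 * l`, and the path that starts at `(s, 0)`
ends at `(t, 2 * l)` with `t = f ^ a (h ^ l s)`. So if the path-orientation problem is solved with
input 1 at `(s, 0)` only, then the last node of exactly one path sees an oriented edge, and this is
the path of `s`. All sources `s` are treated at the same time, by separate groups of machines, and
the new permutation is broadcast along trees whose degree is the local memory; this takes a constant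
number of rounds (`SimLayout.phaseRounds_runs`). No further randomness is needed: whatever the
phase, the simulated inputs are determined by the input graph, so that a union bound shows that one
seed is good for all simulations (`exists_cycles_program`).

The layered graph has at most `N = n ^ (δ' / δ)` nodes, where `δ < δ' < 1`, because `D` is
subpolynomial, and so a local memory of `O(n ^ δ')` words suffices. There are `O(log n / log D)`
phases of `o(log D)` rounds each (`reduction_rounds_isLittleO`).
-/

/-! ### Node configurations in terms of neighbors -/

section NodeMultiset

variable {V : Type} [Fintype V] {G : SimpleGraph V} {I O : Type}

theorem nodeMultiset_eq_map (gin : HalfEdgeLabeling G I) (gout : HalfEdgeLabeling G O) (v : V)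
    (S : Finset G.Dart) (hS : ∀ d, d ∈ S ↔ d.fst = v) :
    nodeMultiset gin gout v = S.val.map fun d => (gin d, gout d) := by
  unfold nodeMultiset
  congr 2
  ext d
  simp [hS]

theorem mem_nodeMultiset (gin : HalfEdgeLabeling G I) (gout : HalfEdgeLabeling G O) (v : V)
    (x : I × O) : x ∈ nodeMultiset gin gout v ↔ ∃ d : G.Dart, d.fst = v ∧ (gin d, gout d) = x := by
  simp [nodeMultiset]

theorem card_nodeMultiset (gin : HalfEdgeLabeling G I) (gout : HalfEdgeLabeling G O) (v : V) :
    (nodeMultiset gin gout v).card = (G.neighborSet v).ncard := by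
  classical
  rw [nodeMultiset_eq_map gin gout v (Finset.univ.filter fun d : G.Dart => d.fst = v) (by simp)]
  rw [Multiset.card_map, Finset.card_val, Set.ncard_eq_toFinset_card']
  refine Finset.card_bij (fun d _ => d.snd) ?_ ?_ ?_
  · rintro ⟨⟨a, b⟩, h⟩ hd
    simp only [Finset.mem_filter, Finset.mem_univ, true_and] at hd
    subst hd
    simpa using h
  · rintro ⟨⟨a, b⟩, h⟩ hd ⟨⟨a', b'⟩, h'⟩ hd' e
    simp at hd hd' e
    simp [hd, hd', e]
  · intro b hb
    exact ⟨⟨(v, b), by simpa using hb⟩, by simp, rfl⟩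

theorem nodeMultiset_of_neighborSet_pair (gin : HalfEdgeLabeling G I) (gout : HalfEdgeLabeling G O)
    {v a b : V} (hab : a ≠ b) (h : G.neighborSet v = {a, b}) (ha : G.Adj v a) (hb : G.Adj v b) :
    nodeMultiset gin gout v = {(gin ⟨(v, a), ha⟩, gout ⟨(v, a), ha⟩),
      (gin ⟨(v, b), hb⟩, gout ⟨(v, b), hb⟩)} := by
  classical
  rw [nodeMultiset_eq_map gin gout v {⟨(v, a), ha⟩, ⟨(v, b), hb⟩}]
  · rw [Finset.insert_val_of_notMem (by simpa using hab)]
    simp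
  · rintro ⟨⟨x, y⟩, hxy⟩
    simp only [Finset.mem_insert, Finset.mem_singleton, SimpleGraph.Dart.mk.injEq, Prod.mk.injEq]
    constructor
    · rintro (⟨rfl, -⟩ | ⟨rfl, -⟩) <;> rfl
    · rintro rfl
      have : y ∈ G.neighborSet x := hxy
      rw [h] at this
      simpa using this

end NodeMultiset

/-! ### Forests -/

section Forest

variable {V : Type} {G : SimpleGraph V}

/-- In a forest, a vertex other than the root `r` of its tree has exactly one neighbor that is
closer to `r`. -/
theorem SimpleGraph.IsAcyclic.exists_parent (hG : G.IsAcyclic) {r v : V} (hr : G.Reachable r v)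
    (hv : v ≠ r) : ∃ u, G.Adj v u ∧ G.dist r v = G.dist r u + 1 ∧
      ∀ w, G.Adj v w → w ≠ u → G.dist r w = G.dist r v + 1 := by
  classical
  obtain ⟨p, hp, hl⟩ := hr.exists_path_of_dist
  have hnil : ¬ p.Nil := fun h => hv h.eq.symm
  have hadj : G.Adj p.penultimate v := p.adj_penultimate hnil
  have key : ∀ w, G.Adj v w → G.dist r v = G.dist r w + 1 → w = p.penultimate := by
    intro w hw hd
    obtain ⟨q, hq, hql⟩ := (hr.trans hw.reachable).exists_path_of_dist
    have hvq : v ∉ q.support := by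
      intro hmem
      have := SimpleGraph.dist_le (q.takeUntil v hmem)
      have := q.length_takeUntil_le_length hmem
      omega
    have hqp := hq.concat hvq hw.symm
    have := (hG.subsingleton_path r v).elim ⟨p, hp⟩ ⟨_, hqp⟩
    have : p = q.concat hw.symm := congrArg Subtype.val this
    rw [this]; simp
  have hor : ∀ w, G.Adj v w → G.dist r v = G.dist r w + 1 ∨ G.dist r w = G.dist r v + 1 := by
    intro w hw
    rcases hG.dist_eq_dist_add_one_of_adj_of_reachable r hw hr with h | h <;> omega
  refine ⟨p.penultimate, hadj.symm, ?_, ?_⟩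
  · rcases hor _ hadj.symm with h | h
    · exact h
    · have h1 := SimpleGraph.dist_le p.dropLast
      have h2 : p.dropLast.length + 1 = p.length := p.length_dropLast_add_one hnil
      omega
  · intro w hw hne
    exact (hor w hw).resolve_left fun h => hne (key w hw h)

end Forest

/-! ### Solutions of the path-orientation problem -/

section PathOrientation

variable {V : Type} [Fintype V] {G : SimpleGraph V} {k : ℕ}
  {gin : HalfEdgeLabeling G Bool} {gout : HalfEdgeLabeling G EdgeStatus}

theorem pathOrientation_isSolution_iff :
    (pathOrientation k).IsSolution gin gout ↔
      (∀ v, (nodeMultiset gin gout v).card ≤ k ∧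
        ((nodeMultiset gin gout v).card = 1 → ∀ x ∈ nodeMultiset gin gout v,
          (x.1 = true → x.2 ≠ EdgeStatus.unoriented) ∧
          (x.1 = false → x.2 ≠ EdgeStatus.outgoing)) ∧
        ((nodeMultiset gin gout v).card = 2 →
          (nodeMultiset gin gout v).map Prod.snd
            = {EdgeStatus.unoriented, EdgeStatus.unoriented} ∨
          (nodeMultiset gin gout v).map Prod.snd
            = {EdgeStatus.incoming, EdgeStatus.outgoing})) ∧
      ∀ d : G.Dart,
        s(gout d, gout d.symm) = s(EdgeStatus.unoriented, EdgeStatus.unoriented) ∨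
        s(gout d, gout d.symm) = s(EdgeStatus.outgoing, EdgeStatus.incoming) :=
  Iff.rfl

theorem pathOrientation_edge (h : (pathOrientation k).IsSolution gin gout) (d : G.Dart) :
    (gout d = .unoriented ∧ gout d.symm = .unoriented) ∨
    (gout d = .outgoing ∧ gout d.symm = .incoming) ∨
    (gout d = .incoming ∧ gout d.symm = .outgoing) := by
  have := (pathOrientation_isSolution_iff.1 h).2 d
  simpa [Sym2.eq_iff] using this

theorem pathOrientation_leaf (h : (pathOrientation k).IsSolution gin gout) (d : G.Dart)
    (hd : (G.neighborSet d.fst).ncard = 1) :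
    (gin d = true → gout d ≠ .unoriented) ∧ (gin d = false → gout d ≠ .outgoing) := by
  have h1 := ((pathOrientation_isSolution_iff.1 h).1 d.fst).2.1 (by rw [card_nodeMultiset]; exact hd)
  exact h1 (gin d, gout d) ((mem_nodeMultiset _ _ _ _).2 ⟨d, rfl, rfl⟩)

theorem pathOrientation_deg_two (h : (pathOrientation k).IsSolution gin gout) {v a b : V}
    (ha : G.Adj v a) (hb : G.Adj v b) (hab : a ≠ b) (hd : (G.neighborSet v).ncard = 2) :
    (gout ⟨(v, a), ha⟩ = .unoriented ∧ gout ⟨(v, b), hb⟩ = .unoriented) ∨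
    (gout ⟨(v, a), ha⟩ = .incoming ∧ gout ⟨(v, b), hb⟩ = .outgoing) ∨
    (gout ⟨(v, a), ha⟩ = .outgoing ∧ gout ⟨(v, b), hb⟩ = .incoming) := by
  have hset : G.neighborSet v = {a, b} := by
    refine (Set.eq_of_subset_of_ncard_le ?_ ?_ (Set.toFinite _)).symm
    · rintro x (rfl | rfl)
      · exact ha
      · exact hb
    · rw [hd, Set.ncard_pair hab]
  have h1 := ((pathOrientation_isSolution_iff.1 h).1 v).2.2 (by rw [card_nodeMultiset]; exact hd)
  rw [nodeMultiset_of_neighborSet_pair gin gout hab hset ha hb] at h1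
  simp only [Multiset.insert_eq_cons, Multiset.map_cons, Multiset.map_singleton] at h1
  generalize gout ⟨(v, a), ha⟩ = x at h1 ⊢
  generalize gout ⟨(v, b), hb⟩ = y at h1 ⊢
  rcases h1 with h1 | h1
  all_goals
    rw [Multiset.cons_eq_cons] at h1
    cases x <;> cases y <;> simp_all

/-- Orientedness propagates along edges if all degrees are at most two. -/
theorem pathOrientation_oriented_of_reachable (h : (pathOrientation k).IsSolution gin gout)
    (hdeg : MaxDegreeLE G 2) {v w : V} (hvw : G.Reachable v w)
    (hv : ∀ d : G.Dart, d.fst = v → gout d ≠ .unoriented) :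
    ∀ d : G.Dart, d.fst = w → gout d ≠ .unoriented := by
  obtain ⟨p⟩ := hvw
  induction p with
  | nil => exact hv
  | @cons a b c hab q ih =>
    apply ih
    have h0 := hv ⟨(a, b), hab⟩ rfl
    have h1 : gout ⟨(b, a), hab.symm⟩ ≠ .unoriented := by
      intro h2
      rcases pathOrientation_edge h ⟨(a, b), hab⟩ with h3 | h3 | h3
      · exact h0 h3.1
      all_goals
        have h4 := h3.2
        simp only [SimpleGraph.Dart.symm, Prod.swap, h2] at h4
        cases h4
    rintro ⟨⟨x, y⟩, hxy⟩ (rfl : x = b)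
    by_cases hya : y = a
    · subst hya; exact h1
    · have h2 : (G.neighborSet x).ncard = 2 := by
        apply le_antisymm (hdeg x)
        rw [← Set.ncard_pair hya]
        apply Set.ncard_le_ncard _ (Set.toFinite _)
        rintro z (rfl | rfl)
        · exact hxy
        · exact hab.symm
      rcases pathOrientation_deg_two h hxy hab.symm hya h2 with h3 | h3 | h3
      · exact absurd h3.2 h1
      all_goals rw [h3.1]; simp

/-- If the edge at a leaf `t` is oriented towards `t`, then so are all edges of its tree. -/
theorem pathOrientation_outgoing_of_leaf (h : (pathOrientation k).IsSolution gin gout)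
    (hG : G.IsAcyclic) (hdeg : MaxDegreeLE G 2) {t : V}
    (ht : ∀ d : G.Dart, d.fst = t → gout d = .incoming) (n : ℕ) :
    ∀ u v (huv : G.Adj v u), G.Reachable t u → G.dist t v = G.dist t u + 1 → G.dist t u = n →
      gout ⟨(v, u), huv⟩ = .outgoing := by
  have flip : ∀ u v (huv : G.Adj v u), gout ⟨(u, v), huv.symm⟩ = .incoming →
      gout ⟨(v, u), huv⟩ = .outgoing := by
    intro u v huv h1
    rcases pathOrientation_edge h ⟨(u, v), huv.symm⟩ with h3 | h3 | h3
    · rw [h1] at h3; cases h3.1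
    · rw [h1] at h3; cases h3.1
    · exact h3.2
  induction n with
  | zero =>
    intro u v huv hr hd h0
    obtain rfl : t = u := hr.dist_eq_zero_iff.1 h0
    exact flip _ _ huv (ht _ rfl)
  | succ n ih =>
    intro u v huv hr hd h0
    have hut : u ≠ t := by rintro rfl; simp at h0
    obtain ⟨u', hu', hd', -⟩ := hG.exists_parent hr hut
    have hvu' : u' ≠ v := by rintro rfl; omega
    have h1 := ih u' u hu' (hr.trans hu'.reachable) hd' (by omega)
    have h2 : (G.neighborSet u).ncard = 2 := by
      apply le_antisymm (hdeg u)
      rw [← Set.ncard_pair hvu']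
      apply Set.ncard_le_ncard _ (Set.toFinite _)
      rintro z (rfl | rfl)
      · exact hu'
      · exact huv.symm
    apply flip
    rcases pathOrientation_deg_two h hu' huv.symm hvu' h2 with h3 | h3 | h3
    · rw [h1] at h3; cases h3.1
    · rw [h1] at h3; cases h3.1
    · exact h3.2

/-- On a disjoint union of paths where `s` is the only node with input 1, a solution tells at a
leaf `t` whether it is connected to the leaf `s`. -/
theorem pathOrientation_reveals (h : (pathOrientation k).IsSolution gin gout)
    (hG : G.IsAcyclic) (hdeg : MaxDegreeLE G 2) {s t : V} (hst : s ≠ t)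
    (hs1 : (G.neighborSet s).ncard = 1) (ht1 : (G.neighborSet t).ncard = 1)
    (hgin : ∀ d : G.Dart, gin d = true ↔ d.fst = s) {d : G.Dart} (hd : d.fst = t) :
    G.Reachable s t ↔ gout d ≠ EdgeStatus.unoriented := by
  constructor
  · intro hr
    refine pathOrientation_oriented_of_reachable h hdeg hr ?_ d hd
    rintro e rfl
    exact (pathOrientation_leaf h e hs1).1 ((hgin e).2 rfl)
  · intro ho
    by_contra hr
    have hin : ∀ e : G.Dart, G.Reachable t e.fst → gin e = false := by
      intro e he
      rw [Bool.eq_false_iff]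
      intro h1
      rw [(hgin e).1 h1] at he
      exact hr he.symm
    have ht : ∀ e : G.Dart, e.fst = t → gout e = .incoming := by
      rintro e rfl
      have hed : e = d := by
        obtain ⟨x, hx⟩ := Set.ncard_eq_one.1 ht1
        have h1 : e.snd ∈ G.neighborSet e.fst := e.adj
        have h2 : d.snd ∈ G.neighborSet e.fst := by
          rw [← hd]; exact d.adj
        rw [hx] at h1 h2
        ext
        · exact hd.symm
        · rw [h1, h2]
      have h1 := (pathOrientation_leaf h e ht1).2 (hin e (SimpleGraph.Reachable.refl _))
      rw [← hed] at ho
      cases h2 : gout e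
      · exact absurd h2 ho
      · exact absurd h2 h1
      · rfl
    have hdeg0 : (G.neighborSet t).Nonempty := by
      rw [Set.nonempty_iff_ne_empty]
      intro h0
      simp [h0] at ht1
    obtain ⟨t', ht'⟩ := hdeg0
    -- a node of the tree of `t` with maximal distance from `t` is a leaf with an outgoing edge
    classical
    obtain ⟨v, hv, hmax⟩ := Finset.exists_max_image
      (Finset.univ.filter fun v => G.Reachable t v) (G.dist t) ⟨t, by simp⟩
    simp only [Finset.mem_filter, Finset.mem_univ, true_and] at hv hmax
    have hvt : v ≠ t := by
      rintro rfl
      have h1 := hmax t' (SimpleGraph.Adj.reachable ht')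
      rw [SimpleGraph.dist_self] at h1
      have := SimpleGraph.dist_eq_one_iff_adj.2 ht'
      omega
    obtain ⟨u, hu, hdu, hw⟩ := hG.exists_parent hv hvt
    have hnb : G.neighborSet v = {u} := by
      ext w
      simp only [SimpleGraph.mem_neighborSet, Set.mem_singleton_iff]
      refine ⟨fun hvw => ?_, fun e => e ▸ hu⟩
      by_contra hne
      have h1 := hw w hvw hne
      have h2 := hmax w (hv.trans hvw.reachable)
      omega
    have h1 := pathOrientation_outgoing_of_leaf h hG hdeg ht _ u v hu (hv.trans hu.reachable)
      hdu rfl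
    exact (pathOrientation_leaf h ⟨(v, u), hu⟩ (by simp [hnb])).2 (hin _ hv) h1

end PathOrientation

/-- Every tree with a node of degree at least three, or with a leaf of input 1, can be oriented
away from this node. In any other tree, all edges may stay unoriented. -/
theorem pathOrientation_solvableOnForests (k : ℕ) : (pathOrientation k).SolvableOnForests := by
  classical
  intro n G hG hdeg gin
  change G.Dart → Bool at gin
  let IsRoot : Fin n → Prop := fun r => 3 ≤ (G.neighborSet r).ncard ∨
    ((G.neighborSet r).ncard = 1 ∧ ∀ d : G.Dart, d.fst = r → gin d = true)
  obtain ⟨root, hroot⟩ : ∃ root : G.ConnectedComponent → Option (Fin n), ∀ c,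
      (∀ r, root c = some r → G.connectedComponentMk r = c ∧ IsRoot r) ∧
      (root c = none → ∀ r, G.connectedComponentMk r = c → ¬ IsRoot r) := by
    refine Classical.axiomOfChoice
      (r := fun (c : G.ConnectedComponent) (o : Option (Fin n)) =>
        (∀ r, o = some r → G.connectedComponentMk r = c ∧ IsRoot r) ∧
        (o = none → ∀ r, G.connectedComponentMk r = c → ¬ IsRoot r)) fun c => ?_
    by_cases h : ∃ r, G.connectedComponentMk r = c ∧ IsRoot r
    · obtain ⟨r, hr⟩ := h
      exact ⟨some r, by rintro _ ⟨⟩; exact hr, by simp⟩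
    · exact ⟨none, by simp, fun _ r hr hr' => h ⟨r, hr, hr'⟩⟩
  let gout : G.Dart → EdgeStatus := fun d => match root (G.connectedComponentMk d.fst) with
    | none => .unoriented
    | some r => if G.dist r d.fst < G.dist r d.snd then .outgoing else .incoming
  have gout_none : ∀ d : G.Dart, root (G.connectedComponentMk d.fst) = none →
      gout d = .unoriented := by
    intro d hd; simp only [gout, hd]
  have gout_some : ∀ (d : G.Dart) r, root (G.connectedComponentMk d.fst) = some r →
      gout d = if G.dist r d.fst < G.dist r d.snd then .outgoing else .incoming := by
    intro d r hd; simp only [gout, hd]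
  refine ⟨gout, pathOrientation_isSolution_iff.2 ⟨?_, ?_⟩⟩
  · intro v
    refine ⟨by rw [card_nodeMultiset]; exact hdeg v, ?_, ?_⟩
    · intro h1 x hx
      rw [card_nodeMultiset] at h1
      obtain ⟨d, rfl, rfl⟩ := (mem_nodeMultiset _ _ _ _).1 hx
      obtain ⟨a, ha⟩ := Set.ncard_eq_one.1 h1
      have huniq : ∀ e : G.Dart, e.fst = d.fst → e = d := by
        intro e he
        have h2 : e.snd ∈ G.neighborSet d.fst := by rw [← he]; exact e.adj
        have h3 : d.snd ∈ G.neighborSet d.fst := d.adj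
        rw [ha] at h2 h3
        exact SimpleGraph.Dart.ext _ _ (Prod.ext he (h2.trans h3.symm))
      cases hc : root (G.connectedComponentMk d.fst) with
      | none =>
        have h2 := (hroot _).2 hc d.fst rfl
        simp only [gout_none d hc]
        refine ⟨fun ht => absurd (Or.inr ⟨h1, fun e he => ?_⟩) h2, fun _ => by simp⟩
        rw [huniq e he]; exact ht
      | some r =>
        obtain ⟨h2, h3⟩ := (hroot _).1 r hc
        have hr : G.Reachable r d.fst := SimpleGraph.ConnectedComponent.exact h2
        simp only [gout_some d r hc]
        by_cases hv : d.fst = r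
        · subst hv
          rcases h3 with h3 | h3
          · omega
          · refine ⟨fun _ => by split_ifs <;> simp, fun hf => ?_⟩
            rw [h3.2 d rfl] at hf; cases hf
        · obtain ⟨u, hu, hdu, -⟩ := hG.exists_parent hr hv
          have h4 := huniq ⟨(d.fst, u), hu⟩ rfl
          have h5 : d.snd = u := by rw [← h4]
          rw [h5, if_neg (by omega)]
          simp
    · intro h1
      rw [card_nodeMultiset] at h1
      obtain ⟨a, b, hab, hn⟩ := Set.ncard_eq_two.1 h1
      have ha : G.Adj v a := by
        rw [← SimpleGraph.mem_neighborSet, hn]; simp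
      have hb : G.Adj v b := by
        rw [← SimpleGraph.mem_neighborSet, hn]; simp
      rw [nodeMultiset_of_neighborSet_pair _ _ hab hn ha hb]
      simp only [Multiset.insert_eq_cons, Multiset.map_cons, Multiset.map_singleton]
      cases hc : root (G.connectedComponentMk v) with
      | none =>
        left
        rw [gout_none ⟨(v, a), ha⟩ hc, gout_none ⟨(v, b), hb⟩ hc]
      | some r =>
        right
        obtain ⟨h2, h3⟩ := (hroot _).1 r hc
        have hr : G.Reachable r v := SimpleGraph.ConnectedComponent.exact h2
        rw [gout_some ⟨(v, a), ha⟩ r hc, gout_some ⟨(v, b), hb⟩ r hc]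
        have hv : v ≠ r := by
          rintro rfl
          rcases h3 with h3 | h3 <;> omega
        obtain ⟨u, hu, hdu, hw⟩ := hG.exists_parent hr hv
        have hu' : u ∈ G.neighborSet v := hu
        rw [hn] at hu'
        rcases hu' with rfl | rfl
        · have := hw b hb hab.symm
          rw [if_neg (by simp only; omega), if_pos (by simp only; omega)]
        · have := hw a ha hab
          rw [if_pos (by simp only; omega), if_neg (by simp only; omega)]
          exact Multiset.pair_comm _ _
  · intro d
    have hcc : G.connectedComponentMk d.symm.fst = G.connectedComponentMk d.fst :=
      SimpleGraph.ConnectedComponent.sound d.adj.symm.reachable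
    cases hc : root (G.connectedComponentMk d.fst) with
    | none =>
      left
      rw [gout_none d hc, gout_none d.symm (by rw [hcc, hc])]
    | some r =>
      right
      obtain ⟨h2, -⟩ := (hroot _).1 r hc
      have hr : G.Reachable r d.fst := SimpleGraph.ConnectedComponent.exact h2
      rw [gout_some d r hc, gout_some d.symm r (by rw [hcc, hc])]
      have e1 : d.symm.fst = d.snd := rfl
      have e2 : d.symm.snd = d.fst := rfl
      rw [e1, e2]
      rcases hG.dist_eq_dist_add_one_of_adj_of_reachable r d.adj hr with h | h
      · rw [if_neg (by omega), if_pos (by omega)]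
        exact Sym2.eq_swap
      · rw [if_pos (by omega), if_neg (by omega)]

/-! ### Layered graphs of permutations -/

/-- A graph in which every edge changes the height by one, and every vertex has at most one lower
neighbor, is a forest: the two neighbors on a cycle of a vertex of maximal height would both be
lower. -/
theorem SimpleGraph.isAcyclic_of_height {V : Type} {G : SimpleGraph V} (ht : V → ℕ)
    (hadj : ∀ a b, G.Adj a b → ht b = ht a + 1 ∨ ht a = ht b + 1)
    (huniq : ∀ a b c, G.Adj a b → G.Adj a c → ht a = ht b + 1 → ht a = ht c + 1 → b = c) :
    G.IsAcyclic := by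
  classical
  intro v c hc
  obtain ⟨u, hu, hmax⟩ := c.support.toFinset.exists_max_image ht ⟨v, by simp⟩
  simp only [List.mem_toFinset] at hu hmax
  have hc' := hc.rotate hu
  have hmem : ∀ w ∈ (c.rotate u hu).support, ht w ≤ ht u := fun w hw =>
    hmax w ((c.mem_support_rotate_iff u hu).1 hw)
  have hnil := hc'.not_nil
  have h1 := (c.rotate u hu).adj_snd hnil
  have h2 := (c.rotate u hu).adj_penultimate hnil
  refine hc'.snd_ne_penultimate (huniq u _ _ h1 h2.symm ?_ ?_)
  · have := hmem _ ((c.rotate u hu).getVert_mem_support 1)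
    rcases hadj _ _ h1 with h | h
    · exact absurd h (by have : ht (c.rotate u hu).snd ≤ ht u := this
                         omega)
    · exact h
  · have := hmem _ ((c.rotate u hu).getVert_mem_support ((c.rotate u hu).length - 1))
    rcases hadj _ _ h2.symm with h | h
    · exact absurd h (by have : ht (c.rotate u hu).penultimate ≤ ht u := this
                         omega)
    · exact h

/-- The composition `π (l - 1) ∘ ⋯ ∘ π 0`. -/
def layerComp {X : Type} (π : ℕ → Equiv.Perm X) : ℕ → Equiv.Perm X
  | 0 => 1
  | l + 1 => π l * layerComp π l

/-- The graph with a node `code (y, l)` for every `y : X` and every layer `l ≤ L`, in which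
`code (y, l)` is adjacent to `code (π l y, l + 1)`. It consists of one path of length `L` for every
element of `X`, and of isolated nodes. -/
def layeredGraph {X V : Type} {L : ℕ} (code : X × Fin (L + 1) ↪ V) (π : ℕ → Equiv.Perm X) :
    SimpleGraph V where
  Adj a b :=
    (∃ (y : X) (l : Fin L), a = code (y, l.castSucc) ∧ b = code (π l y, l.succ)) ∨
    (∃ (y : X) (l : Fin L), b = code (y, l.castSucc) ∧ a = code (π l y, l.succ))
  symm := ⟨fun _ _ h => h.symm⟩
  loopless := ⟨by
    rintro a (⟨y, l, h1, h2⟩ | ⟨y, l, h1, h2⟩)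
    all_goals
      have := congrArg Prod.snd (code.injective (h1.symm.trans h2))
      simp [Fin.ext_iff] at this⟩

namespace layeredGraph

variable {X V : Type} {L : ℕ} {code : X × Fin (L + 1) ↪ V} {π : ℕ → Equiv.Perm X}

theorem adj_code_iff {y : X} {i : Fin (L + 1)} {b : V} :
    (layeredGraph code π).Adj (code (y, i)) b ↔
      (∃ l : Fin L, i = l.castSucc ∧ b = code (π l y, l.succ)) ∨
      (∃ l : Fin L, i = l.succ ∧ b = code ((π l).symm y, l.castSucc)) := by
  constructor
  · rintro (⟨z, l, h1, h2⟩ | ⟨z, l, h1, h2⟩)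
    · obtain ⟨rfl, rfl⟩ := Prod.mk.inj (code.injective h1)
      exact Or.inl ⟨l, rfl, h2⟩
    · obtain ⟨rfl, rfl⟩ := Prod.mk.inj (code.injective h2)
      exact Or.inr ⟨l, rfl, by simpa using h1⟩
  · rintro (⟨l, rfl, rfl⟩ | ⟨l, rfl, rfl⟩)
    · exact Or.inl ⟨y, l, rfl, rfl⟩
    · exact Or.inr ⟨(π l).symm y, l, rfl, by simp⟩

theorem exists_code_of_adj {a b : V} (h : (layeredGraph code π).Adj a b) : ∃ p, a = code p := by
  rcases h with ⟨y, l, h1, -⟩ | ⟨y, l, -, h1⟩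
  · exact ⟨_, h1⟩
  · exact ⟨_, h1⟩

/-- The neighbors of a node of the element `y` only depend on what the permutations and their
inverses do to `y`. -/
theorem adj_code_congr {π' : ℕ → Equiv.Perm X} {y : X} (h : ∀ l, π l y = π' l y)
    (h' : ∀ l, (π l).symm y = (π' l).symm y) (i : Fin (L + 1)) (b : V) :
    (layeredGraph code π).Adj (code (y, i)) b ↔ (layeredGraph code π').Adj (code (y, i)) b := by
  simp only [adj_code_iff, h, h']

theorem isAcyclic : (layeredGraph code π).IsAcyclic := by
  have hext : ∀ p, Function.extend code (fun p => p.2.val) 0 (code p) = p.2.val := fun p =>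
    code.injective.extend_apply _ _ p
  refine SimpleGraph.isAcyclic_of_height (Function.extend code (fun p => p.2.val) 0) ?_ ?_
  · intro a b h
    obtain ⟨⟨y, i⟩, rfl⟩ := exists_code_of_adj h
    rcases adj_code_iff.1 h with ⟨l, rfl, rfl⟩ | ⟨l, rfl, rfl⟩
    · left; rw [hext, hext]; simp
    · right; rw [hext, hext]; simp
  · intro a b c hab hac hb hc
    obtain ⟨⟨y, i⟩, rfl⟩ := exists_code_of_adj hab
    rcases adj_code_iff.1 hab with ⟨l, rfl, rfl⟩ | ⟨l, rfl, rfl⟩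
    · rw [hext, hext] at hb; simp at hb; omega
    rcases adj_code_iff.1 hac with ⟨l', hl, rfl⟩ | ⟨l', hl, rfl⟩
    · rw [hext, hext] at hc
      simp only [hl, Fin.val_succ, Fin.val_castSucc] at hc
      omega
    · obtain rfl := Fin.succ_injective _ hl
      rfl

theorem maxDegreeLE_two : MaxDegreeLE (layeredGraph code π) 2 := by
  intro a
  by_cases ha : ∃ p, a = code p
  · obtain ⟨⟨y, i⟩, rfl⟩ := ha
    have h1 : (layeredGraph code π).neighborSet (code (y, i)) =
        {b | ∃ l : Fin L, i = l.castSucc ∧ b = code (π l y, l.succ)} ∪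
        {b | ∃ l : Fin L, i = l.succ ∧ b = code ((π l).symm y, l.castSucc)} := by
      ext b
      exact adj_code_iff
    rw [h1]
    refine (Set.ncard_union_le _ _).trans (Nat.add_le_add (b := 1) (d := 1) ?_ ?_)
    · have : {b | ∃ l : Fin L, i = l.castSucc ∧ b = code (π l y, l.succ)}.Subsingleton := by
        rintro _ ⟨l, rfl, rfl⟩ _ ⟨l', h, rfl⟩
        obtain rfl := Fin.castSucc_injective _ h
        rfl
      exact (Set.ncard_le_one this.finite).2 fun a ha b hb => this ha hb
    · have : {b | ∃ l : Fin L, i = l.succ ∧ b = code ((π l).symm y, l.castSucc)}.Subsingleton := by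
        rintro _ ⟨l, rfl, rfl⟩ _ ⟨l', h, rfl⟩
        obtain rfl := Fin.succ_injective _ h
        rfl
      exact (Set.ncard_le_one this.finite).2 fun a ha b hb => this ha hb
  · have : (layeredGraph code π).neighborSet a = ∅ := by
      ext b
      simp only [SimpleGraph.mem_neighborSet, Set.mem_empty_iff_false, iff_false]
      exact fun h => ha (exists_code_of_adj h)
    simp [this]

theorem neighborSet_first (hL : 0 < L) (y : X) :
    (layeredGraph code π).neighborSet (code (y, 0)) = {code (π 0 y, Fin.succ ⟨0, hL⟩)} := by
  ext b
  simp only [SimpleGraph.mem_neighborSet, Set.mem_singleton_iff, adj_code_iff]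
  constructor
  · rintro (⟨l, h, rfl⟩ | ⟨l, h, rfl⟩)
    · have : l = ⟨0, hL⟩ := by
        ext
        simpa using (congrArg Fin.val h).symm
      rw [this]
    · exact absurd h (Fin.succ_ne_zero l).symm
  · rintro rfl
    exact Or.inl ⟨⟨0, hL⟩, rfl, rfl⟩

theorem neighborSet_last (hL : 0 < L) (y : X) :
    (layeredGraph code π).neighborSet (code (y, Fin.last L)) =
      {code ((π (L - 1)).symm y, Fin.castSucc ⟨L - 1, by omega⟩)} := by
  ext b
  simp only [SimpleGraph.mem_neighborSet, Set.mem_singleton_iff, adj_code_iff]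
  constructor
  · rintro (⟨l, h, rfl⟩ | ⟨l, h, rfl⟩)
    · exact absurd h (Fin.castSucc_lt_last l).ne'
    · have : l = ⟨L - 1, by omega⟩ := by
        ext
        have := congrArg Fin.val h
        simp only [Fin.val_last, Fin.val_succ] at this
        simp only
        omega
      rw [this]
  · rintro rfl
    refine Or.inr ⟨⟨L - 1, by omega⟩, ?_, rfl⟩
    ext
    simp only [Fin.val_last, Fin.val_succ]
    omega

/-- The path of the element `x`. -/
theorem exists_walk (x : X) (i k : ℕ) (h : i + k < L + 1) :
    ∃ p : (layeredGraph code π).Walk (code (layerComp π i x, ⟨i, by omega⟩))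
      (code (layerComp π (i + k) x, ⟨i + k, h⟩)), p.length = k := by
  induction k with
  | zero => exact ⟨.nil, rfl⟩
  | succ k ih =>
    obtain ⟨p, hp⟩ := ih (by omega)
    refine ⟨p.concat (adj_code_iff.2 (Or.inl ⟨⟨i + k, by omega⟩, rfl, rfl⟩)), ?_⟩
    simp [hp]

/-- Two nodes that are connected belong to the path of the same element. -/
theorem eq_of_reachable {p q : X × Fin (L + 1)}
    (h : (layeredGraph code π).Reachable (code p) (code q)) :
    (layerComp π p.2).symm p.1 = (layerComp π q.2).symm q.1 := by
  let root : V → Option X :=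
    Function.extend code (fun p => some ((layerComp π p.2).symm p.1)) fun _ => none
  have hext : ∀ p, root (code p) = some ((layerComp π p.2).symm p.1) := fun p =>
    code.injective.extend_apply _ _ p
  have hwalk : ∀ a b, (layeredGraph code π).Walk a b → root a = root b := by
    intro a b w
    induction w with
    | nil => rfl
    | cons hadj _ ih =>
      rw [← ih]
      obtain ⟨⟨y, i⟩, rfl⟩ := exists_code_of_adj hadj
      rcases adj_code_iff.1 hadj with ⟨l, rfl, rfl⟩ | ⟨l, rfl, rfl⟩
      · rw [hext, hext, Option.some_inj, Equiv.eq_symm_apply]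
        simp [layerComp]
      · rw [hext, hext, Option.some_inj, Equiv.symm_apply_eq]
        simp [layerComp]
  obtain ⟨w⟩ := h
  have := hwalk _ _ w
  rw [hext, hext] at this
  exact Option.some.inj this

theorem reachable_iff {s t : X} :
    (layeredGraph code π).Reachable (code (s, 0)) (code (t, Fin.last L)) ↔
      layerComp π L s = t := by
  constructor
  · intro h
    have h1 := eq_of_reachable h
    simp only [Fin.val_zero, layerComp, Fin.val_last] at h1
    rw [Equiv.eq_symm_apply] at h1
    exact h1
  · rintro rfl
    obtain ⟨p, -⟩ := exists_walk (code := code) (π := π) s 0 L (by omega)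
    simp only [zero_add] at p
    exact ⟨p⟩

theorem componentDiamLE : ComponentDiamLE (layeredGraph code π) L := by
  have main : ∀ (x : X) (i j : ℕ) (hi : i < L + 1) (hj : j < L + 1), i ≤ j →
      (layeredGraph code π).dist (code (layerComp π i x, ⟨i, hi⟩))
        (code (layerComp π j x, ⟨j, hj⟩)) ≤ L := by
    intro x i j hi hj hij
    obtain ⟨k, rfl⟩ := Nat.exists_eq_add_of_le hij
    obtain ⟨p, hp⟩ := exists_walk (code := code) (π := π) x i k hj
    have := SimpleGraph.dist_le p
    omega
  intro u v huv
  by_cases he : u = v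
  · subst he; simp
  have hcode : ∀ a b, (layeredGraph code π).Reachable a b → a ≠ b → ∃ p, a = code p := by
    rintro a b ⟨w⟩ hab
    cases w with
    | nil => exact absurd rfl hab
    | cons h _ => exact exists_code_of_adj h
  obtain ⟨⟨y, i⟩, rfl⟩ := hcode _ _ huv he
  obtain ⟨⟨z, j⟩, rfl⟩ := hcode _ _ huv.symm (Ne.symm he)
  have h1 := eq_of_reachable huv
  simp only at h1
  obtain ⟨x, hx⟩ : ∃ x, x = (layerComp π i).symm y := ⟨_, rfl⟩
  have hy : y = layerComp π i x := by simp [hx]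
  have hz : z = layerComp π j x := by simp [hx, h1]
  rw [hy, hz]
  rcases le_total i j with hij | hij
  · exact main x i j i.2 j.2 hij
  · rw [SimpleGraph.dist_comm]
    exact main x j i j.2 i.2 hij

end layeredGraph

/-- The layers of a phase: `l` steps of `h`, then `a` steps of `f`; the remaining steps are idle. -/
def phaseLayers {X : Type} (f h : Equiv.Perm X) (l a i : ℕ) : Equiv.Perm X :=
  if i < l then h else if i < l + a then f else 1

theorem layerComp_phaseLayers {X : Type} (f h : Equiv.Perm X) {l a L : ℕ} (hL : l + a ≤ L) :
    layerComp (phaseLayers f h l a) L = f ^ a * h ^ l := by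
  have h1 : ∀ i ≤ l, layerComp (phaseLayers f h l a) i = h ^ i := by
    intro i hi
    induction i with
    | zero => rfl
    | succ i ih =>
      rw [layerComp, ih (by omega), phaseLayers, if_pos (by omega), pow_succ']
  have h2 : ∀ i ≤ a, layerComp (phaseLayers f h l a) (l + i) = f ^ i * h ^ l := by
    intro i hi
    induction i with
    | zero => simp [h1 l le_rfl]
    | succ i ih =>
      rw [← add_assoc, layerComp, ih (by omega), phaseLayers, if_neg (by omega),
        if_pos (by omega), pow_succ', mul_assoc]
  obtain ⟨k, rfl⟩ := Nat.exists_eq_add_of_le hL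
  clear hL
  induction k with
  | zero => exact h2 a le_rfl
  | succ k ih =>
    rw [← add_assoc, layerComp, ih, phaseLayers, if_neg (by omega), if_neg (by omega), one_mul]

/-! ### Walking along the cycles of a 2-regular graph -/

section NextDart

variable {V : Type} {G G' : SimpleGraph V}

/-- Every vertex has exactly two neighbors. -/
def TwoRegular (G : SimpleGraph V) : Prop := ∀ v, (G.neighborSet v).ncard = 2

/-- The two neighbors of `v` in `G`, numbered by `Bool`. The numbering depends on nothing but `v`
and its set of neighbors. If there are not exactly two neighbors, the value is `v`. -/
noncomputable def port (G : SimpleGraph V) (v : V) : Bool → V :=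
  open Classical in
  if h : ∃ p : Bool → V, Function.Injective p ∧ Set.range p = G.neighborSet v then h.choose
  else fun _ => v

theorem port_congr {v : V} (h : G.neighborSet v = G'.neighborSet v) : port G v = port G' v := by
  unfold port
  rw [h]

theorem TwoRegular.port_spec (hG : TwoRegular G) (v : V) :
    Function.Injective (port G v) ∧ Set.range (port G v) = G.neighborSet v := by
  have h : ∃ p : Bool → V, Function.Injective p ∧ Set.range p = G.neighborSet v := by
    obtain ⟨a, b, hab, hn⟩ := Set.ncard_eq_two.1 (hG v)
    refine ⟨fun i => if i then a else b, ?_, ?_⟩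
    · rintro (_ | _) (_ | _) <;> simp [hab, hab.symm]
    · rw [hn]
      ext x
      simp [eq_comm, or_comm]
  unfold port
  rw [dif_pos h]
  exact h.choose_spec

theorem TwoRegular.adj_port (hG : TwoRegular G) (v : V) (b : Bool) : G.Adj v (port G v b) := by
  have : port G v b ∈ G.neighborSet v := (hG.port_spec v).2 ▸ Set.mem_range_self b
  exact this

/-- A pair `(v, b)` stands for the dart from `v` to its neighbor `port G v b`; this is the opposite
dart. -/
noncomputable def reverseDart (G : SimpleGraph V) (d : V × Bool) : V × Bool :=
  open Classical in
  (port G d.1 d.2, decide (port G (port G d.1 d.2) true = d.1))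

theorem TwoRegular.port_reverseDart (hG : TwoRegular G) (d : V × Bool) :
    port G (reverseDart G d).1 (reverseDart G d).2 = d.1 := by
  obtain ⟨v, b⟩ := d
  have h1 : v ∈ G.neighborSet (port G v b) := (hG.adj_port v b).symm
  rw [← (hG.port_spec _).2] at h1
  obtain ⟨c, hc⟩ := h1
  unfold reverseDart
  simp only
  by_cases ht : port G (port G v b) true = v
  · simp [ht]
  · cases c
    · simp [ht, hc]
    · exact absurd hc ht

theorem TwoRegular.reverseDart_involutive (hG : TwoRegular G) :
    Function.Involutive (reverseDart G) := by
  intro d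
  have h1 := hG.port_reverseDart d
  have h2 := hG.port_reverseDart (reverseDart G d)
  have h3 : (reverseDart G (reverseDart G d)).1 = d.1 := h1
  rw [h3] at h2
  refine Prod.ext h3 ((hG.port_spec d.1).1 (h2.trans ?_))
  rfl

/-- The permutation of the darts that continues every dart by the next one on its cycle. -/
noncomputable def nextDart (hG : TwoRegular G) : Equiv.Perm (V × Bool) :=
  hG.reverseDart_involutive.toPerm.trans (Equiv.prodCongr (Equiv.refl V) Equiv.boolNot)

theorem nextDart_apply (hG : TwoRegular G) (d : V × Bool) :
    nextDart hG d = ((reverseDart G d).1, !(reverseDart G d).2) := rfl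

theorem nextDart_symm_apply (hG : TwoRegular G) (d : V × Bool) :
    (nextDart hG).symm d = reverseDart G (d.1, !d.2) := rfl

theorem nextDart_fst (hG : TwoRegular G) (d : V × Bool) :
    (nextDart hG d).1 = port G d.1 d.2 := rfl

theorem port_nextDart_ne (hG : TwoRegular G) (d : V × Bool) :
    port G (nextDart hG d).1 (nextDart hG d).2 ≠ d.1 := by
  rw [nextDart_apply]
  intro h
  have h1 := (hG.port_spec _).1 (h.trans (hG.port_reverseDart d).symm)
  simp at h1

/-- The next and the previous dart only depend on the neighborhoods of the starting point of the
dart and of its neighbors. -/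
theorem nextDart_congr (hG : TwoRegular G) (hG' : TwoRegular G') {v : V}
    (h : G.neighborSet v = G'.neighborSet v)
    (h' : ∀ u, G.Adj v u → G.neighborSet u = G'.neighborSet u) (b : Bool) :
    nextDart hG (v, b) = nextDart hG' (v, b) ∧
      (nextDart hG).symm (v, b) = (nextDart hG').symm (v, b) := by
  have key : ∀ c, reverseDart G (v, c) = reverseDart G' (v, c) := by
    intro c
    have h2 := port_congr (h' _ (hG.adj_port v c))
    unfold reverseDart
    rw [port_congr h] at h2 ⊢
    simp only
    rw [h2]
  rw [nextDart_apply, nextDart_apply, nextDart_symm_apply, nextDart_symm_apply, key, key]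
  exact ⟨rfl, rfl⟩

/-- If the cycle of the starting point of a dart is parametrized by the group `A` with
generator `g`, then iterating `nextDart` from this dart has the period `addOrderOf g`. -/
theorem nextDart_pow_eq_self_iff (hG : TwoRegular G) {A : Type} [AddCommGroup A] {g : A}
    {e : A → V} (he : Function.Injective e)
    (hN : ∀ a, G.neighborSet (e a) = {e (a - g), e (a + g)}) {d : V × Bool}
    (hd : d.1 ∈ Set.range e) (k : ℕ) :
    (nextDart hG ^ k) d = d ↔ addOrderOf g ∣ k := by
  obtain ⟨a, ha⟩ := hd
  have hp : ∀ (d : V × Bool) a, e a = d.1 → port G d.1 d.2 = e (a - g) ∨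
      port G d.1 d.2 = e (a + g) := by
    intro d a ha
    have h1 : port G d.1 d.2 ∈ G.neighborSet d.1 := hG.adj_port _ _
    rw [← ha, hN, ha] at h1
    exact h1
  obtain ⟨ε, hε, hpε⟩ : ∃ ε, (ε = g ∨ ε = -g) ∧ port G d.1 d.2 = e (a + ε) := by
    rcases hp d a ha with h | h
    · exact ⟨-g, Or.inr rfl, by rw [h, sub_eq_add_neg]⟩
    · exact ⟨g, Or.inl rfl, h⟩
  have hord : addOrderOf g ∣ k ↔ k • ε = 0 := by
    rw [addOrderOf_dvd_iff_nsmul_eq_zero]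
    rcases hε with rfl | rfl
    · rfl
    · rw [smul_neg, neg_eq_zero]
  have hstep : ∀ k : ℕ, e (a + k • ε) = ((nextDart hG ^ k) d).1 ∧
      port G ((nextDart hG ^ k) d).1 ((nextDart hG ^ k) d).2 = e (a + (k + 1) • ε) := by
    intro k
    induction k with
    | zero => simpa using ⟨ha, hpε⟩
    | succ k ih =>
      obtain ⟨h1, h2⟩ := ih
      rw [pow_succ', Equiv.Perm.mul_apply]
      generalize (nextDart hG ^ k) d = d' at h1 h2
      have h3 : e (a + (k + 1) • ε) = (nextDart hG d').1 := by rw [nextDart_fst, h2]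
      refine ⟨h3, ?_⟩
      have h4 := port_nextDart_ne hG d'
      rw [← h1] at h4
      have e1 : a + (k + 1) • ε - ε = a + k • ε := by rw [add_smul, one_smul]; abel
      have e2 : a + (k + 1) • ε + ε = a + (k + 1 + 1) • ε := by
        rw [add_smul (k + 1) 1, one_smul]; abel
      rcases hp _ _ h3 with h5 | h5 <;> rcases hε with rfl | rfl
      · rw [e1] at h5; exact absurd h5 h4
      · rw [← sub_neg_eq_add] at e2; rw [h5, ← e2]; simp
      · rw [h5, e2]
      · rw [sub_neg_eq_add] at e1
        rw [e1] at h5; exact absurd h5 h4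
  rw [hord]
  obtain ⟨h1, h2⟩ := hstep k
  constructor
  · intro h
    rw [h, ← ha] at h1
    simpa using he h1
  · intro h
    rw [h, add_zero, ha] at h1
    rw [add_smul, h, zero_add, one_smul, ← hpε, ← h1] at h2
    exact Prod.ext h1.symm ((hG.port_spec d.1).1 h2)

end NextDart

theorem SimpleGraph.neighborSet_iso_symm {V W : Type} {G : SimpleGraph V} {H : SimpleGraph W}
    (φ : G ≃g H) (w : W) : G.neighborSet (φ.symm w) = φ.symm '' H.neighborSet w := by
  ext x
  simp only [SimpleGraph.mem_neighborSet, Set.mem_image]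
  constructor
  · intro h
    exact ⟨φ x, by simpa using φ.map_adj_iff.2 h, by simp⟩
  · rintro ⟨y, hy, rfl⟩
    exact φ.symm.map_adj_iff.2 hy

theorem addOrderOf_fin_one (m : ℕ) : addOrderOf (1 : Fin (m + 3)) = m + 3 :=
  ZMod.addOrderOf_one (m + 3)

theorem fin_sub_one_ne_add_one {m : ℕ} (a : Fin (m + 3)) : a - 1 ≠ a + 1 := by
  intro h
  have h2 : addOrderOf (1 : Fin (m + 3)) ∣ 2 := by
    rw [addOrderOf_dvd_iff_nsmul_eq_zero, two_nsmul]
    have : a + (1 + 1) = a := by rw [← add_assoc, ← h]; abel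
    simpa using this
  rw [addOrderOf_fin_one] at h2
  have := Nat.le_of_dvd (by norm_num) h2
  omega

theorem IsOneCycle.exists_param {n : ℕ} {G : SimpleGraph (Fin n)} (h : IsOneCycle G) :
    ∃ m, n = m + 3 ∧ ∃ e : Fin (m + 3) → Fin n, Function.Bijective e ∧
      ∀ a, G.neighborSet (e a) = {e (a - 1), e (a + 1)} := by
  obtain ⟨hn, ⟨φ⟩⟩ := h
  obtain ⟨m, rfl⟩ := Nat.exists_eq_add_of_le' hn
  refine ⟨m, rfl, φ.symm, φ.symm.bijective, fun a => ?_⟩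
  rw [SimpleGraph.neighborSet_iso_symm, SimpleGraph.cycleGraph_neighborSet, Set.image_pair]

theorem IsTwoCycles.exists_param {n : ℕ} {G : SimpleGraph (Fin n)} (h : IsTwoCycles G) :
    ∃ m, n = 2 * (m + 3) ∧ ∀ v, ∃ e : Fin (m + 3) → Fin n, Function.Injective e ∧
      v ∈ Set.range e ∧ ∀ a, G.neighborSet (e a) = {e (a - 1), e (a + 1)} := by
  obtain ⟨m, hm, rfl, ⟨φ⟩⟩ := h
  obtain ⟨m, rfl⟩ := Nat.exists_eq_add_of_le' hm
  refine ⟨m, rfl, fun v => ?_⟩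
  have hl : ∀ a, ((SimpleGraph.cycleGraph (m + 3)) ⊕g (SimpleGraph.cycleGraph (m + 3))).neighborSet
      (Sum.inl a) = Sum.inl '' (SimpleGraph.cycleGraph (m + 3)).neighborSet a := by
    intro a; ext (x | x) <;> simp
  have hr : ∀ a, ((SimpleGraph.cycleGraph (m + 3)) ⊕g (SimpleGraph.cycleGraph (m + 3))).neighborSet
      (Sum.inr a) = Sum.inr '' (SimpleGraph.cycleGraph (m + 3)).neighborSet a := by
    intro a; ext (x | x) <;> simp
  rcases hv : φ v with a | a
  · refine ⟨fun a => φ.symm (Sum.inl a), φ.symm.injective.comp Sum.inl_injective,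
      ⟨a, by simp [← hv]⟩, fun a => ?_⟩
    rw [SimpleGraph.neighborSet_iso_symm, hl, SimpleGraph.cycleGraph_neighborSet, Set.image_pair,
      Set.image_pair]
  · refine ⟨fun a => φ.symm (Sum.inr a), φ.symm.injective.comp Sum.inr_injective,
      ⟨a, by simp [← hv]⟩, fun a => ?_⟩
    rw [SimpleGraph.neighborSet_iso_symm, hr, SimpleGraph.cycleGraph_neighborSet, Set.image_pair,
      Set.image_pair]

theorem twoRegular_of_cycles {n : ℕ} {G : SimpleGraph (Fin n)}
    (h : IsOneCycle G ∨ IsTwoCycles G) : TwoRegular G := by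
  intro v
  rcases h with h | h
  · obtain ⟨m, -, e, he, hN⟩ := h.exists_param
    obtain ⟨a, rfl⟩ := he.2 v
    rw [hN, Set.ncard_pair fun hh => fin_sub_one_ne_add_one a (he.1 hh)]
  · obtain ⟨m, -, hv⟩ := h.exists_param
    obtain ⟨e, he, ⟨a, rfl⟩, hN⟩ := hv v
    rw [hN, Set.ncard_pair fun hh => fin_sub_one_ne_add_one a (he hh)]

/-- In one cycle on `n` nodes, `n / 2` steps do not lead back to the start; in a cycle on `n / 2`
nodes they do. -/
theorem nextDart_pow_ne_self_iff {n : ℕ} {G : SimpleGraph (Fin n)}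
    (h : IsOneCycle G ∨ IsTwoCycles G) (hG : TwoRegular G) (d : Fin n × Bool) :
    (nextDart hG ^ (n / 2)) d ≠ d ↔ IsOneCycle G := by
  have h1 : IsOneCycle G → (nextDart hG ^ (n / 2)) d ≠ d := by
    intro h
    obtain ⟨m, hn, e, he, hN⟩ := h.exists_param
    rw [Ne, nextDart_pow_eq_self_iff hG he.1 hN (he.2 d.1), addOrderOf_fin_one]
    intro hd
    have := Nat.le_of_dvd (by omega) hd
    omega
  refine ⟨fun hne => ?_, h1⟩
  rcases h with h | h
  · exact h
  · obtain ⟨m, hn, hv⟩ := h.exists_param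
    obtain ⟨e, he, hd, hN⟩ := hv d.1
    refine absurd ((nextDart_pow_eq_self_iff hG he hN hd _).2 ?_) hne
    rw [addOrderOf_fin_one, hn, Nat.mul_div_cancel_left _ (by norm_num)]

/-! ### Executions of sequences of rounds -/

/-- The memories of `M` machines. -/
abbrev MPCConfig (M : ℕ) : Type := Fin M → List (Fin M)

/-- What the machines do in one round. -/
structure MPCRound (M : ℕ) where
  send : Fin M → List (Fin M) → Fin M → List (Fin M)
  update : Fin M → List (Fin M) → (Fin M → List (Fin M)) → List (Fin M)

namespace MPCRound

variable {M : ℕ}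

/-- The memories after the round. -/
def step (R : MPCRound M) (c : MPCConfig M) : MPCConfig M :=
  fun j => R.update j (c j) fun i => R.send i (c i) j

/-- No machine sends or receives more than `S` words. -/
def Fits (R : MPCRound M) (S : ℕ) (c : MPCConfig M) : Prop :=
  (∀ i, ∑ j, (R.send i (c i) j).length ≤ S) ∧ ∀ j, ∑ i, (R.send i (c i) j).length ≤ S

/-- A round without communication. -/
def loc (u : Fin M → List (Fin M) → List (Fin M)) : MPCRound M where
  send _ _ _ := []
  update i mem _ := u i mem

theorem loc_fits (u : Fin M → List (Fin M) → List (Fin M)) (S : ℕ) (c : MPCConfig M) :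
    (loc u).Fits S c := by
  constructor <;> intro i <;> simp [loc]

/-- Every machine `j` adopts the memory of the machine `σ j`. -/
def pull (σ : Fin M → Fin M) : MPCRound M where
  send i mem j := if σ j = i then mem else []
  update j _ msgs := msgs (σ j)

theorem pull_step (σ : Fin M → Fin M) (c : MPCConfig M) : (pull σ).step c = c ∘ σ := by
  funext j
  simp [step, pull]

theorem pull_fits {σ : Fin M → Fin M} {B w S : ℕ}
    (hσ : ∀ i, (Finset.univ.filter fun j => σ j = i).card ≤ B) {c : MPCConfig M}
    (hc : ∀ i, (c i).length ≤ w) (hw : w ≤ S) (hBw : B * w ≤ S) : (pull σ).Fits S c := by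
  constructor
  · intro i
    simp only [pull, apply_ite List.length, List.length_nil, ← Finset.sum_filter,
      Finset.sum_const, smul_eq_mul]
    exact (Nat.mul_le_mul (hσ i) (hc i)).trans hBw
  · intro j
    simp only [pull, apply_ite List.length, List.length_nil, Finset.sum_ite_eq, Finset.mem_univ,
      if_true]
    exact (hc _).trans hw

end MPCRound

theorem sum_length_le {ι α : Type} [Fintype ι] (F : ι → List α) (s : Finset ι) (w : ℕ)
    (h : ∀ i ∈ s, (F i).length ≤ w) (h0 : ∀ i ∉ s, F i = []) :
    ∑ i, (F i).length ≤ s.card * w := by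
  rw [← Finset.sum_subset (Finset.subset_univ s) fun i _ hi => by simp [h0 i hi]]
  exact (Finset.sum_le_card_nsmul _ _ _ h).trans (by simp)

/-- The execution of the rounds `Rs` leads from the memories `c` to the memories `c'`, and no
machine ever stores, sends or receives more than `S` words. -/
inductive MPCRuns {M : ℕ} (S : ℕ) : List (MPCRound M) → MPCConfig M → MPCConfig M → Prop
  | nil (c : MPCConfig M) (hc : ∀ i, (c i).length ≤ S) : MPCRuns S [] c c
  | cons (R : MPCRound M) (Rs : List (MPCRound M)) (c c' : MPCConfig M)
      (hc : ∀ i, (c i).length ≤ S) (hR : R.Fits S c) (h : MPCRuns S Rs (R.step c) c') :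
      MPCRuns S (R :: Rs) c c'

namespace MPCRuns

variable {M S : ℕ}

theorem append {Rs Rs' : List (MPCRound M)} {c c' c'' : MPCConfig M} (h : MPCRuns S Rs c c')
    (h' : MPCRuns S Rs' c' c'') : MPCRuns S (Rs ++ Rs') c c'' := by
  induction h with
  | nil => exact h'
  | cons R Rs c c' hc hR _ ih => exact .cons _ _ _ _ hc hR (ih h')

theorem single {R : MPCRound M} {c c' : MPCConfig M} (hc : ∀ i, (c i).length ≤ S)
    (hR : R.Fits S c) (hstep : R.step c = c') (hc' : ∀ i, (c' i).length ≤ S) :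
    MPCRuns S [R] c c' := by
  subst hstep
  exact .cons _ _ _ _ hc hR (.nil _ hc')

theorem flatMap_range {prot : ℕ → List (MPCRound M)} {c : ℕ → MPCConfig M}
    (h0 : ∀ i, (c 0 i).length ≤ S) (P : ℕ) (h : ∀ j < P, MPCRuns S (prot j) (c j) (c (j + 1))) :
    MPCRuns S ((List.range P).flatMap prot) (c 0) (c P) := by
  induction P with
  | zero => exact .nil _ h0
  | succ P ih =>
    rw [List.range_succ, List.flatMap_append]
    refine (ih fun j hj => h j (by omega)).append ?_
    simpa using h P (by omega)

theorem map_range {R : ℕ → MPCRound M} {c : ℕ → MPCConfig M} (T : ℕ)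
    (hc : ∀ r ≤ T, ∀ i, (c r i).length ≤ S) (hR : ∀ r < T, (R r).Fits S (c r))
    (hstep : ∀ r < T, (R r).step (c r) = c (r + 1)) :
    MPCRuns S ((List.range T).map R) (c 0) (c T) := by
  rw [← List.flatMap_pure_eq_map]
  exact flatMap_range (hc 0 (by omega)) T fun r hr =>
    single (hc r (by omega)) (hR r hr) (hstep r hr) (hc (r + 1) (by omega))

end MPCRuns

/-- The program that executes the rounds `prot`, which may depend on the seed. -/
def MPCProgram.ofRounds {n M : ℕ} {I Res : Type} (Seed : Type) (hfin : Finite Seed)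
    (hne : Nonempty Seed) (load : Fin M → LocalInput n I → List (Fin M))
    (prot : Seed → List (MPCRound M)) (out : Fin M → List (Fin M) → Res) :
    MPCProgram n M I Res where
  Seed := Seed
  finite_seed := hfin
  nonempty_seed := hne
  load _ := load
  send ω r := ((prot ω).getD r (MPCRound.loc fun _ mem => mem)).send
  update ω r := ((prot ω).getD r (MPCRound.loc fun _ mem => mem)).update
  output _ := out

theorem MPCProgram.ofRounds_spec {n M : ℕ} {I Res : Type} {Seed : Type} {hfin : Finite Seed}
    {hne : Nonempty Seed} {load : Fin M → LocalInput n I → List (Fin M)}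
    {prot : Seed → List (MPCRound M)} {out : Fin M → List (Fin M) → Res} {S : ℕ} {S' : ℝ}
    (hS : (S : ℝ) ≤ S') {ω : Seed} {x : Fin M → LocalInput n I} {c : MPCConfig M}
    (h : MPCRuns S (prot ω) (fun i => load i (x i)) c) :
    (ofRounds Seed hfin hne load prot out).WithinBudget ω x (prot ω).length S' ∧
    (ofRounds Seed hfin hne load prot out).result ω x (prot ω).length =
      fun i => out i (c i) := by
  set A := ofRounds Seed hfin hne load prot out with hA
  let Rd : ℕ → MPCRound M := fun r => (prot ω).getD r (MPCRound.loc fun _ mem => mem)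
  have hstep : ∀ r, A.memory ω x (r + 1) = (Rd r).step (A.memory ω x r) := fun r => rfl
  have main : ∀ Rs (c c' : MPCConfig M), MPCRuns S Rs c c' → ∀ r,
      (∀ k < Rs.length, (prot ω)[r + k]? = Rs[k]?) → A.memory ω x r = c →
      (∀ k ≤ Rs.length, ∀ i, (A.memory ω x (r + k) i).length ≤ S) ∧
      (∀ k < Rs.length, (Rd (r + k)).Fits S (A.memory ω x (r + k))) ∧
      A.memory ω x (r + Rs.length) = c' := by
    intro Rs c c' h
    induction h with
    | nil c hc =>
      intro r _ hr
      refine ⟨?_, by simp, by simpa using hr⟩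
      intro k hk i
      obtain rfl : k = 0 := by simpa using hk
      rw [add_zero, hr]
      exact hc i
    | cons R Rs c c' hc hR _ ih =>
      intro r hget hr
      have h0 : Rd r = R := by
        have := hget 0 (by simp)
        simp only [add_zero, List.getElem?_cons_zero] at this
        simp [Rd, List.getD, this]
      obtain ⟨h1, h2, h3⟩ := ih (r + 1) (fun k hk => by
        have := hget (k + 1) (by simpa using hk)
        rw [List.getElem?_cons_succ] at this
        rw [← this]
        congr 1
        omega) (by rw [hstep, h0, hr])
      refine ⟨?_, ?_, ?_⟩
      · intro k hk i
        rcases k with _ | k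
        · rw [add_zero, hr]; exact hc i
        · have := h1 k (by simpa using hk) i
          rwa [add_right_comm, add_assoc] at this
      · intro k hk
        rcases k with _ | k
        · rw [add_zero, hr, h0]; exact hR
        · have := h2 k (by simpa using hk)
          rwa [add_right_comm, add_assoc] at this
      · rw [List.length_cons, ← h3, add_right_comm, add_assoc]
  obtain ⟨h1, h2, h3⟩ := main _ _ _ h 0 (by simp) rfl
  simp only [zero_add] at h1 h2 h3
  refine ⟨⟨?_, ?_, ?_⟩, ?_⟩
  · intro r hr i
    exact le_trans (by exact_mod_cast h1 r hr i) hS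
  · intro r hr i
    exact le_trans (by exact_mod_cast (h2 r hr).1 i) hS
  · intro r hr j
    exact le_trans (by exact_mod_cast (h2 r hr).2 j) hS
  · funext i
    unfold result
    rw [h3]
    rfl

/-! ### Broadcasting -/

/-- An idempotent map `g` is an iterate of a map with small fibers: in every fiber of `g`, numbered
from `0` such that `g` is constantly the element with number `0`, divide the numbers by `B`. -/
theorem exists_iterate_eq_of_idempotent {ι : Type} [Fintype ι] [DecidableEq ι] (g : ι → ι)
    (hg : ∀ i, g (g i) = g i) {B d : ℕ} (hB : 0 < B)
    (hcard : Fintype.card ι ≤ B ^ d) :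
    ∃ σ : ι → ι, (∀ i, (Finset.univ.filter fun j => σ j = i).card ≤ B) ∧ σ^[d] = g := by
  classical
  have hnum : ∀ i, g i = i → ∃ e : {j // g j = i} ≃ Fin (Fintype.card {j // g j = i}),
      ∀ h : g i = i, (e ⟨i, h⟩).val = 0 := by
    intro i hi
    have hpos : 0 < Fintype.card {j // g j = i} := Fintype.card_pos_iff.2 ⟨⟨i, hi⟩⟩
    let e := Fintype.equivFin {j // g j = i}
    exact ⟨e.trans (Equiv.swap (e ⟨i, hi⟩) ⟨0, hpos⟩), fun h => by simp⟩
  choose e he using hnum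
  let rank : ι → ℕ := fun j => (e (g j) (hg j) ⟨j, rfl⟩).val
  have hrank : ∀ i (hi : g i = i) j (hj : g j = i), rank j = (e i hi ⟨j, hj⟩).val := by
    rintro i hi j rfl
    rfl
  have hrank0 : ∀ j, rank (g j) = 0 := by
    intro j
    rw [hrank (g j) (hg j) (g j) (hg j)]
    exact he _ _ _
  have hinj : ∀ j j', g j = g j' → rank j = rank j' → j = j' := by
    intro j j' h h'
    rw [hrank (g j') (hg j') j h, hrank (g j') (hg j') j' rfl] at h'
    exact congrArg Subtype.val ((e _ _).injective (Fin.ext h'))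
  have hex : ∀ j, ∃ j', g j' = g j ∧ rank j' = rank j / B := by
    intro j
    let k : Fin (Fintype.card {j' // g j' = g j}) :=
      ⟨rank j / B, lt_of_le_of_lt (Nat.div_le_self _ _) (e (g j) (hg j) ⟨j, rfl⟩).2⟩
    refine ⟨((e (g j) (hg j)).symm k).1, ((e (g j) (hg j)).symm k).2, ?_⟩
    rw [hrank (g j) (hg j) _ ((e (g j) (hg j)).symm k).2]
    simp [k]
  choose σ hσg hσr using hex
  refine ⟨σ, ?_, ?_⟩
  · intro i
    have hsub : ∀ j ∈ Finset.univ.filter (fun j => σ j = i),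
        rank j ∈ Finset.Ico (B * rank i) (B * rank i + B) := by
      intro j hj
      obtain rfl := (Finset.mem_filter.1 hj).2
      rw [hσr, Finset.mem_Ico]
      exact ⟨Nat.mul_div_le _ _, by rw [mul_comm]; exact Nat.lt_div_mul_add hB⟩
    refine (Finset.card_le_card_of_injOn rank hsub ?_).trans (by simp)
    intro j hj j' hj' h
    have h1 := (Finset.mem_filter.1 hj).2
    have h2 := (Finset.mem_filter.1 hj').2
    exact hinj j j' (by rw [← hσg j, ← hσg j', h1, h2]) h
  · have hit : ∀ m j, g (σ^[m] j) = g j ∧ rank (σ^[m] j) = rank j / B ^ m := by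
      intro m j
      induction m with
      | zero => simp
      | succ m ih =>
        rw [Function.iterate_succ_apply', hσg, hσr, ih.1, ih.2, Nat.div_div_eq_div_mul, pow_succ]
        exact ⟨rfl, rfl⟩
    funext j
    apply hinj
    · rw [(hit d j).1, hg]
    · rw [(hit d j).2, hrank0]
      refine Nat.div_eq_of_lt (lt_of_lt_of_le ?_ hcard)
      exact lt_of_lt_of_le (e (g j) (hg j) ⟨j, rfl⟩).2 (Fintype.card_subtype_le _)

/-- If `g` is idempotent, all machines `i` can adopt the memory of the machine `g i` in `d` rounds,
where `B ^ d` is at least the number of machines and `B` the fan-out. -/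
theorem exists_broadcast {M : ℕ} (g : Fin M → Fin M) (hg : ∀ i, g (g i) = g i) {B d : ℕ}
    (hB : 0 < B) (hcard : M ≤ B ^ d) :
    ∃ Rs : List (MPCRound M), Rs.length = d ∧ ∀ (S w : ℕ) (c : MPCConfig M),
      (∀ i, (c i).length ≤ w) → B * w ≤ S → MPCRuns S Rs c (c ∘ g) := by
  obtain ⟨σ, hσ, hit⟩ := exists_iterate_eq_of_idempotent g hg hB (d := d) (by simpa using hcard)
  refine ⟨(List.range d).map fun _ => MPCRound.pull σ, by simp, fun S w c hc hS => ?_⟩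
  have hw : w ≤ S := (Nat.le_mul_of_pos_left w hB).trans hS
  rw [← hit]
  exact MPCRuns.map_range (c := fun r => c ∘ σ^[r]) d (fun r _ i => (hc _).trans hw)
    (fun r _ => MPCRound.pull_fits hσ (fun i => hc _) hw hS)
    (fun r _ => by rw [MPCRound.pull_step, Function.comp_assoc, ← Function.iterate_succ])

/-! ### One phase: composing permutations by means of path orientations -/

/-- Every node has input 0, except for the first node on the path of `s`. -/
def sourceInput {X : Type} {L N : ℕ} (code : X × Fin (L + 1) ↪ Fin N) (π : ℕ → Equiv.Perm X)
    (s : X) : HalfEdgeLabeling (layeredGraph code π) Bool :=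
  fun d => decide (d.fst = code (s, 0))

/-- The numberings used when `M` machines simulate a program for `K` machines and graphs with `N`
nodes on one copy of a layered graph for every element of `X`. -/
structure SimLayout (X : Type) (L N K M : ℕ) where
  /-- the nodes of the layered graphs; the other nodes are isolated -/
  code : X × Fin (L + 1) ↪ Fin N
  /-- the distribution of the nodes in the simulated executions -/
  host : Fin N ↪ Fin K
  /-- `machine (s, q)` simulates the machine `q` in the copy for the source `s` -/
  machine : X × Fin K ↪ Fin M
  /-- the encoding of the words of the simulated program -/
  up : Fin K ↪ Fin M
  /-- the encoding of the elements of `X` by words -/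
  word : X ↪ Fin M
  /-- an arbitrary element -/
  base : X

theorem sum_length_eq_of_embedding {ι κ α : Type} [Fintype ι] [Fintype κ] (e : κ ↪ ι)
    (F : ι → List α) (h0 : ∀ i ∉ Set.range e, F i = []) :
    ∑ i, (F i).length = ∑ k, (F (e k)).length := by
  classical
  rw [← Finset.sum_map Finset.univ e fun i => (F i).length]
  refine (Finset.sum_subset (Finset.subset_univ _) fun i _ hi => ?_).symm
  rw [h0 i (by simpa using hi)]
  rfl

namespace SimLayout

variable {X : Type} {L N K M : ℕ} (Λ : SimLayout X L N K M)

/-- The machine that holds the node `code (y, l)` in the copy for the source `s`. -/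
def slot : X × X × Fin (L + 1) ↪ Fin M where
  toFun p := Λ.machine (p.1, Λ.host (Λ.code p.2))
  inj' p p' h := by
    have := Prod.mk.inj (Λ.machine.injective h)
    exact Prod.ext this.1 (Λ.code.injective (Λ.host.injective this.2))

/-- The element of `X` that a machine is responsible for. -/
noncomputable def elt (i : Fin M) : X :=
  Function.extend Λ.slot (fun p => p.2.1) (fun _ => Λ.base) i

/-- The machine from which the information on an element is broadcast. -/
def root (y : X) : Fin M := Λ.slot (Λ.base, y, 0)

@[simp]
theorem elt_slot (p : X × X × Fin (L + 1)) : Λ.elt (Λ.slot p) = p.2.1 :=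
  Λ.slot.injective.extend_apply _ _ p

@[simp]
theorem elt_root (y : X) : Λ.elt (Λ.root y) = y := Λ.elt_slot _

theorem root_injective : Function.Injective Λ.root := fun y y' h => by
  rw [← Λ.elt_root y, h, Λ.elt_root]

/-- What a machine responsible for `y` remembers about the permutations `f` and `h`. -/
def side (f h : Equiv.Perm X) (y : X) : List (Fin M) :=
  [Λ.word (h y), Λ.word (h.symm y), Λ.word (f y), Λ.word (f.symm y)]

/-- Every machine knows the values of `f`, `h` and their inverses at its element. -/
noncomputable def ready (f h : Equiv.Perm X) : MPCConfig M := fun i => Λ.side f h (Λ.elt i)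

theorem side_length (f h : Equiv.Perm X) (y : X) : (Λ.side f h y).length = 4 := rfl

/-- The input of the machine `q` in the copy for the source `s`. -/
def copyInput (π : ℕ → Equiv.Perm X) (s : X) (q : Fin K) : LocalInput N Bool :=
  localInput (sourceInput Λ.code π s) Λ.host q

theorem copyInput_congr {π π' : ℕ → Equiv.Perm X} {y : X} (h : ∀ l, π l y = π' l y)
    (h' : ∀ l, (π l).symm y = (π' l).symm y) (s : X) {q : Fin K}
    (hq : ∀ p, Λ.host (Λ.code p) = q → p.1 = y) : Λ.copyInput π s q = Λ.copyInput π' s q := by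
  have key : ∀ {π π' : ℕ → Equiv.Perm X}, (∀ l, π l y = π' l y) →
      (∀ l, (π l).symm y = (π' l).symm y) →
      (Λ.copyInput π s q).halfEdges ⊆ (Λ.copyInput π' s q).halfEdges := by
    rintro π π' h h' _ ⟨⟨⟨a, b⟩, hd⟩, hq', rfl⟩
    obtain ⟨⟨z, i⟩, rfl⟩ := layeredGraph.exists_code_of_adj hd
    obtain rfl : z = y := hq _ hq'
    exact ⟨⟨(Λ.code (z, i), b), (layeredGraph.adj_code_congr h h' i b).1 hd⟩, hq', rfl⟩
  have h1 := (key h h').antisymm (key (fun l => (h l).symm) fun l => (h' l).symm)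
  unfold copyInput localInput at h1 ⊢
  rw [LocalInput.mk.injEq]
  exact ⟨rfl, h1⟩

theorem phaseLayers_congr {f h f' h' : Equiv.Perm X} {y : X}
    (hs : Λ.side f h y = Λ.side f' h' y) (l a : ℕ) :
    (∀ i, phaseLayers f h l a i y = phaseLayers f' h' l a i y) ∧
      ∀ i, (phaseLayers f h l a i).symm y = (phaseLayers f' h' l a i).symm y := by
  simp only [side, List.cons.injEq, EmbeddingLike.apply_eq_iff_eq, and_true] at hs
  obtain ⟨h1, h2, h3, h4⟩ := hs
  constructor <;> intro i <;> unfold phaseLayers <;> split_ifs <;> first | assumption | rfl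

/-- The simulated input is computed from the information on the element of the machine, by taking
any two permutations that agree with this information. -/
noncomputable def inputOf (l a : ℕ) (s : X) (q : Fin K) (mem : List (Fin M)) :
    LocalInput N Bool :=
  open Classical in
  if h : ∃ fh : Equiv.Perm X × Equiv.Perm X,
      mem = Λ.side fh.1 fh.2 (Λ.elt (Λ.machine (s, q))) then
    Λ.copyInput (phaseLayers h.choose.1 h.choose.2 l a) s q
  else ⟨∅, ∅⟩

theorem inputOf_side (f h : Equiv.Perm X) (l a : ℕ) (s : X) (q : Fin K) :
    Λ.inputOf l a s q (Λ.side f h (Λ.elt (Λ.machine (s, q)))) =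
      Λ.copyInput (phaseLayers f h l a) s q := by
  have hex : ∃ fh : Equiv.Perm X × Equiv.Perm X,
      Λ.side f h (Λ.elt (Λ.machine (s, q))) = Λ.side fh.1 fh.2 (Λ.elt (Λ.machine (s, q))) :=
    ⟨(f, h), rfl⟩
  unfold inputOf
  rw [dif_pos hex]
  obtain ⟨h1, h2⟩ := Λ.phaseLayers_congr hex.choose_spec l a
  refine (Λ.copyInput_congr h1 h2 s ?_).symm
  rintro p rfl
  exact (Λ.elt_slot (s, p)).symm

/-- Decoding words of the simulated program. -/
noncomputable def down (mem : List (Fin M)) : List (Fin K) :=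
  mem.filterMap (Function.partialInv Λ.up)

@[simp]
theorem down_map_up (mem : List (Fin K)) : Λ.down (mem.map Λ.up) = mem := by
  unfold down
  rw [List.filterMap_map]
  have : Function.partialInv Λ.up ∘ Λ.up = some :=
    funext fun x => Function.partialInv_left Λ.up.injective x
  rw [this, List.filterMap_some]

/-- The copy and the simulated machine that a machine is in charge of. -/
noncomputable def decode (i : Fin M) : Option (X × Fin K) := Function.partialInv Λ.machine i

@[simp]
theorem decode_machine (p : X × Fin K) : Λ.decode (Λ.machine p) = some p :=
  Function.partialInv_left Λ.machine.injective p

theorem machine_of_decode {i : Fin M} {p : X × Fin K} (h : Λ.decode i = some p) :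
    Λ.machine p = i :=
  (Λ.machine.injective.isPartialInv p i).1 h

/-- The memories during the simulation: the information on the permutations, followed by the
memories `mems` of the simulated machines. -/
noncomputable def simConfig (f h : Equiv.Perm X) (mems : X → Fin K → List (Fin K)) :
    MPCConfig M := fun i =>
  Λ.side f h (Λ.elt i) ++ match Λ.decode i with
    | some p => (mems p.1 p.2).map Λ.up
    | none => []

theorem simConfig_machine (f h : Equiv.Perm X) (mems : X → Fin K → List (Fin K))
    (p : X × Fin K) : Λ.simConfig f h mems (Λ.machine p) =
      Λ.side f h (Λ.elt (Λ.machine p)) ++ (mems p.1 p.2).map Λ.up := by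
  simp [simConfig]

theorem simConfig_take (f h : Equiv.Perm X) (mems : X → Fin K → List (Fin K)) (i : Fin M) :
    (Λ.simConfig f h mems i).take 4 = Λ.side f h (Λ.elt i) := by
  simp [simConfig, side]

theorem simConfig_drop_machine (f h : Equiv.Perm X) (mems : X → Fin K → List (Fin K))
    (p : X × Fin K) : Λ.down ((Λ.simConfig f h mems (Λ.machine p)).drop 4) = mems p.1 p.2 := by
  rw [simConfig_machine]
  simp [side]

theorem simConfig_length (f h : Equiv.Perm X) {mems : X → Fin K → List (Fin K)} {S : ℕ}
    (hm : ∀ s q, (mems s q).length ≤ S) (i : Fin M) :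
    (Λ.simConfig f h mems i).length ≤ 4 + S := by
  unfold simConfig
  rw [List.length_append, side_length]
  cases Λ.decode i with
  | none => simp
  | some p => simpa using hm p.1 p.2

section Simulation

variable {Res : Type} (A : MPCProgram N K Bool Res) (ω : A.Seed)

/-- The local computation that starts the simulation. -/
noncomputable def loadRound (l a : ℕ) : MPCRound M :=
  .loc fun i mem => mem ++ match Λ.decode i with
    | some p => (A.load ω p.2 (Λ.inputOf l a p.1 p.2 mem)).map Λ.up
    | none => []

/-- One round of the simulation, in all copies at the same time. -/
noncomputable def simRound (r : ℕ) : MPCRound M where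
  send i mem j := match Λ.decode i, Λ.decode j with
    | some p, some p' =>
      open Classical in
      if p.1 = p'.1 then (A.send ω r p.2 (Λ.down (mem.drop 4)) p'.2).map Λ.up else []
    | _, _ => []
  update j mem msgs := mem.take 4 ++ match Λ.decode j with
    | some p => (A.update ω r p.2 (Λ.down (mem.drop 4))
        fun q => Λ.down (msgs (Λ.machine (p.1, q)))).map Λ.up
    | none => []

variable {A ω}

theorem loadRound_step (f h : Equiv.Perm X) (l a : ℕ) :
    (Λ.loadRound A ω l a).step (Λ.ready f h) = Λ.simConfig f h fun s =>
      A.memory ω (Λ.copyInput (phaseLayers f h l a) s) 0 := by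
  funext i
  change Λ.ready f h i ++ _ = Λ.side f h (Λ.elt i) ++ _
  congr 1
  cases hi : Λ.decode i with
  | none => rfl
  | some p =>
    obtain rfl := Λ.machine_of_decode hi
    simp only [ready, MPCProgram.memory]
    rw [Λ.inputOf_side]

theorem simRound_send_machine (f h : Equiv.Perm X) (mems : X → Fin K → List (Fin K)) (r : ℕ)
    (s : X) (q q' : Fin K) :
    (Λ.simRound A ω r).send (Λ.machine (s, q)) (Λ.simConfig f h mems (Λ.machine (s, q)))
      (Λ.machine (s, q')) = (A.send ω r q (mems s q) q').map Λ.up := by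
  simp only [simRound, decode_machine, simConfig_drop_machine, if_true]

theorem simRound_step (f h : Equiv.Perm X) (x : X → Fin K → LocalInput N Bool) (r : ℕ) :
    (Λ.simRound A ω r).step (Λ.simConfig f h fun s => A.memory ω (x s) r) =
      Λ.simConfig f h fun s => A.memory ω (x s) (r + 1) := by
  funext j
  have h1 := Λ.simConfig_take f h (fun s => A.memory ω (x s) r) j
  change List.take 4 _ ++ _ = Λ.side f h (Λ.elt j) ++ _
  rw [h1]
  congr 1
  cases hj : Λ.decode j with
  | none => rfl
  | some p =>
    obtain rfl := Λ.machine_of_decode hj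
    simp only [MPCProgram.memory, simConfig_drop_machine]
    congr 3
    funext q
    rw [show p = (p.1, p.2) from rfl, simRound_send_machine, down_map_up]

theorem simRound_fits (f h : Equiv.Perm X) {x : X → Fin K → LocalInput N Bool} {r S : ℕ}
    (hs : ∀ s q, ∑ q', (A.send ω r q (A.memory ω (x s) r q) q').length ≤ S)
    (hr : ∀ s q', ∑ q, (A.send ω r q (A.memory ω (x s) r q) q').length ≤ S) :
    (Λ.simRound A ω r).Fits S (Λ.simConfig f h fun s => A.memory ω (x s) r) := by
  have hnil : ∀ i j mem, (∀ s q q', ¬ (i = Λ.machine (s, q) ∧ j = Λ.machine (s, q'))) →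
      (Λ.simRound A ω r).send i mem j = [] := by
    intro i j mem hij
    rcases hi : Λ.decode i with _ | ⟨s, q⟩ <;> rcases hj : Λ.decode j with _ | ⟨s', q'⟩ <;>
      simp only [simRound, hi, hj]
    rw [if_neg]
    rintro rfl
    exact hij s q q' ⟨(Λ.machine_of_decode hi).symm, (Λ.machine_of_decode hj).symm⟩
  let e : X → Fin K ↪ Fin M := fun s =>
    ⟨fun q => Λ.machine (s, q), fun q q' h => (Prod.mk.inj (Λ.machine.injective h)).2⟩
  constructor
  · intro i
    by_cases hi : ∃ s q, i = Λ.machine (s, q)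
    · obtain ⟨s, q, rfl⟩ := hi
      rw [sum_length_eq_of_embedding (e s)]
      · refine le_trans (le_of_eq (Finset.sum_congr rfl fun q' _ => ?_)) (hs s q)
        change ((Λ.simRound A ω r).send _ _ (Λ.machine (s, q'))).length = _
        rw [simRound_send_machine, List.length_map]
      · intro j hj
        refine hnil _ _ _ ?_
        rintro s' q₁ q₂ ⟨h1, rfl⟩
        obtain rfl := (Prod.mk.inj (Λ.machine.injective h1)).1
        exact hj ⟨q₂, rfl⟩
    · rw [Finset.sum_eq_zero]
      · exact Nat.zero_le _
      · intro j _
        rw [hnil _ _ _ fun s q q' hh => hi ⟨s, q, hh.1⟩, List.length_nil]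
  · intro j
    by_cases hj : ∃ s q, j = Λ.machine (s, q)
    · obtain ⟨s, q', rfl⟩ := hj
      rw [sum_length_eq_of_embedding (e s)]
      · refine le_trans (le_of_eq (Finset.sum_congr rfl fun q _ => ?_)) (hr s q')
        change ((Λ.simRound A ω r).send (Λ.machine (s, q)) _ _).length = _
        rw [show e s q = Λ.machine (s, q) from rfl, simRound_send_machine, List.length_map]
      · intro i hi
        refine hnil _ _ _ ?_
        rintro s' q₁ q₂ ⟨rfl, h1⟩
        obtain rfl := (Prod.mk.inj (Λ.machine.injective h1)).1
        exact hi ⟨q₁, rfl⟩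
    · rw [Finset.sum_eq_zero]
      · exact Nat.zero_le _
      · intro i _
        rw [hnil _ _ _ fun s q q' hh => hj ⟨s, q', hh.2⟩, List.length_nil]

/-- The simulation of `T` rounds in all copies. -/
theorem simRounds_runs (f h : Equiv.Perm X) {x : X → Fin K → LocalInput N Bool} {T S : ℕ}
    {S' : ℝ} (hS : 4 + ⌊S'⌋₊ ≤ S) (hA : ∀ s, A.WithinBudget ω (x s) T S') :
    MPCRuns S ((List.range T).map (Λ.simRound A ω))
      (Λ.simConfig f h fun s => A.memory ω (x s) 0)
      (Λ.simConfig f h fun s => A.memory ω (x s) T) := by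
  refine MPCRuns.map_range (c := fun r => Λ.simConfig f h fun s => A.memory ω (x s) r) T ?_ ?_ ?_
  · intro r hr i
    exact (Λ.simConfig_length f h (fun s q => Nat.le_floor ((hA s).1 r hr q)) i).trans hS
  · intro r hr
    have hS' : ⌊S'⌋₊ ≤ S := by omega
    exact Λ.simRound_fits f h (fun s q => (Nat.le_floor ((hA s).2.1 r hr q)).trans hS')
      fun s q => (Nat.le_floor ((hA s).2.2 r hr q)).trans hS'
  · intro r _
    exact Λ.simRound_step f h x r

end Simulation

section Return

variable (A : MPCProgram N K Bool (Fin N → Fin N → EdgeStatus)) (ω : A.Seed)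

/-- At the end of the simulation, the machine that holds the last node on the path of `t` can tell
whether the edge at this node is oriented. The neighbor in question is computed from the
information on the permutations, as in `inputOf`. -/
def SeesOriented (l a : ℕ) (t : X) (mem : List (Fin M)) : Prop :=
  ∃ (f h : Equiv.Perm X) (b : Fin N), mem.take 4 = Λ.side f h t ∧
    (layeredGraph Λ.code (phaseLayers f h l a)).Adj (Λ.code (t, Fin.last L)) b ∧
    A.output ω (Λ.host (Λ.code (t, Fin.last L))) (Λ.down (mem.drop 4))
      (Λ.code (t, Fin.last L)) b ≠ .unoriented

/-- If the path in the copy for `s` is found to end at `t`, a signal is sent to the machines from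
which the information on `s` and on `t` is broadcast. The content of the signal does not matter:
its sender determines `s` and `t`. -/
noncomputable def returnRound (l a : ℕ) : MPCRound M where
  send i mem j :=
    open Classical in
    if ∃ s t, i = Λ.slot (s, t, Fin.last L) ∧ (j = Λ.root s ∨ j = Λ.root t) ∧
      Λ.SeesOriented A ω l a t mem then [i] else []
  update j mem msgs :=
    haveI : Nonempty X := ⟨Λ.base⟩
    [Λ.word (Classical.epsilon fun t => msgs (Λ.slot (Λ.elt j, t, Fin.last L)) ≠ []),
      Λ.word (Classical.epsilon fun s => msgs (Λ.slot (s, Λ.elt j, Fin.last L)) ≠ [])] ++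
      (mem.take 4).drop 2

/-- The seed `ω` lets `A` solve the path-orientation problem in all copies of the phase that
replaces `h` by `f ^ a * h ^ l`. -/
def GoodSeed (k T : ℕ) (S' : ℝ) (f h : Equiv.Perm X) (l a : ℕ) (s : X) : Prop :=
  A.WithinBudget ω (Λ.copyInput (phaseLayers f h l a) s) T S' ∧
  (pathOrientation k).IsSolution (sourceInput Λ.code (phaseLayers f h l a) s)
    fun d => A.result ω (Λ.copyInput (phaseLayers f h l a) s) T (Λ.host d.fst) d.fst d.snd

variable {A ω}

theorem seesOriented_iff {k T : ℕ} {S' : ℝ} {f h : Equiv.Perm X} {l a : ℕ} {s : X} (hL : 0 < L)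
    (hla : l + a ≤ L) (hgood : Λ.GoodSeed A ω k T S' f h l a s) (t : X) :
    Λ.SeesOriented A ω l a t (Λ.simConfig f h (fun s =>
      A.memory ω (Λ.copyInput (phaseLayers f h l a) s) T) (Λ.slot (s, t, Fin.last L))) ↔
      (f ^ a * h ^ l) s = t := by
  have hst : Λ.code (s, 0) ≠ Λ.code (t, Fin.last L) := by
    intro he
    have := congrArg Fin.val (Prod.mk.inj (Λ.code.injective he)).2
    simp at this
    omega
  have hleaf := layeredGraph.neighborSet_last (code := Λ.code) (π := phaseLayers f h l a) hL t
  have hadj : (layeredGraph Λ.code (phaseLayers f h l a)).Adj (Λ.code (t, Fin.last L))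
      (Λ.code ((phaseLayers f h l a (L - 1)).symm t, Fin.castSucc ⟨L - 1, by omega⟩)) := by
    rw [← SimpleGraph.mem_neighborSet, hleaf]
    rfl
  have hrev := pathOrientation_reveals hgood.2 layeredGraph.isAcyclic
    layeredGraph.maxDegreeLE_two hst (by rw [layeredGraph.neighborSet_first hL]; simp)
    (by rw [hleaf]; simp) (fun d => by simp [sourceInput]) (d := ⟨(_, _), hadj⟩) rfl
  rw [layeredGraph.reachable_iff, layerComp_phaseLayers f h hla] at hrev
  rw [hrev]
  unfold SeesOriented
  rw [simConfig_take, show Λ.slot (s, t, Fin.last L) =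
    Λ.machine (s, Λ.host (Λ.code (t, Fin.last L))) from rfl, simConfig_drop_machine,
    show Λ.machine (s, Λ.host (Λ.code (t, Fin.last L))) = Λ.slot (s, t, Fin.last L) from rfl,
    elt_slot]
  constructor
  · rintro ⟨f', h', b, hs, hb, hne⟩
    obtain ⟨h1, h2⟩ := Λ.phaseLayers_congr hs l a
    rw [← layeredGraph.adj_code_congr h1 h2, ← SimpleGraph.mem_neighborSet, hleaf] at hb
    obtain rfl : b = _ := hb
    exact hne
  · intro hne
    exact ⟨f, h, _, rfl, hadj, hne⟩

theorem returnRound_runs {k T S : ℕ} {S' : ℝ} {f h : Equiv.Perm X} {l a : ℕ} (hL : 0 < L)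
    (hla : l + a ≤ L) (hgood : ∀ s, Λ.GoodSeed A ω k T S' f h l a s) (hS : 4 + ⌊S'⌋₊ ≤ S) :
    ∃ c : MPCConfig M, (∀ i, (c i).length ≤ 4) ∧
      (∀ y, c (Λ.root y) = Λ.side f (f ^ a * h ^ l) y) ∧
      MPCRuns S [Λ.returnRound A ω l a] (Λ.simConfig f h fun s =>
        A.memory ω (Λ.copyInput (phaseLayers f h l a) s) T) c := by
  classical
  set c₀ := Λ.simConfig f h fun s => A.memory ω (Λ.copyInput (phaseLayers f h l a) s) T with hc₀
  set h' := f ^ a * h ^ l with hh'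
  have hsend : ∀ i j, (Λ.returnRound A ω l a).send i (c₀ i) j =
      if ∃ s, i = Λ.slot (s, h' s, Fin.last L) ∧ (j = Λ.root s ∨ j = Λ.root (h' s))
        then [i] else [] := by
    intro i j
    unfold returnRound
    simp only
    congr 1
    rw [eq_iff_iff]
    constructor
    · rintro ⟨s, t, rfl, hj, hsee⟩
      obtain rfl := (Λ.seesOriented_iff hL hla (hgood s) t).1 hsee
      exact ⟨s, rfl, hj⟩
    · rintro ⟨s, rfl, hj⟩
      exact ⟨s, h' s, rfl, hj, (Λ.seesOriented_iff hL hla (hgood s) _).2 rfl⟩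
  have hsend_slot : ∀ s t j, (Λ.returnRound A ω l a).send (Λ.slot (s, t, Fin.last L))
      (c₀ (Λ.slot (s, t, Fin.last L))) j ≠ [] ↔ h' s = t ∧ (j = Λ.root s ∨ j = Λ.root t) := by
    intro s t j
    rw [hsend]
    simp only [ne_eq, ite_eq_right_iff, List.cons_ne_nil, imp_false, not_not,
      EmbeddingLike.apply_eq_iff_eq, Prod.mk.injEq, and_true]
    constructor
    · rintro ⟨s', ⟨rfl, rfl⟩, hj⟩
      exact ⟨rfl, hj⟩
    · rintro ⟨rfl, hj⟩
      exact ⟨s, ⟨rfl, rfl⟩, hj⟩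
  refine ⟨(Λ.returnRound A ω l a).step c₀, ?_, ?_, ?_⟩
  · intro i
    simp only [MPCRound.step, returnRound, List.length_append, List.length_drop, List.length_take,
      List.length_cons, List.length_nil]
    omega
  · intro y
    have h1 : ∀ t, (Λ.returnRound A ω l a).send (Λ.slot (y, t, Fin.last L))
        (c₀ (Λ.slot (y, t, Fin.last L))) (Λ.root y) ≠ [] ↔ t = h' y := by
      intro t
      rw [hsend_slot]
      simp [eq_comm]
    have h2 : ∀ s, (Λ.returnRound A ω l a).send (Λ.slot (s, y, Fin.last L))
        (c₀ (Λ.slot (s, y, Fin.last L))) (Λ.root y) ≠ [] ↔ s = h'.symm y := by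
      intro s
      rw [hsend_slot, Equiv.eq_symm_apply]
      simp
    have : Nonempty X := ⟨Λ.base⟩
    change [Λ.word (Classical.epsilon fun t => (Λ.returnRound A ω l a).send
        (Λ.slot (Λ.elt (Λ.root y), t, Fin.last L)) (c₀ _) (Λ.root y) ≠ []),
      Λ.word (Classical.epsilon fun s => (Λ.returnRound A ω l a).send
        (Λ.slot (s, Λ.elt (Λ.root y), Fin.last L)) (c₀ _) (Λ.root y) ≠ [])] ++
        ((c₀ (Λ.root y)).take 4).drop 2 = _
    rw [hc₀, simConfig_take, ← hc₀, elt_root]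
    simp only [h1, h2]
    rw [Classical.epsilon_singleton, Classical.epsilon_singleton]
    rfl
  · have hlen : ∀ i j, ((Λ.returnRound A ω l a).send i (c₀ i) j).length ≤ 1 := by
      intro i j
      rw [hsend]
      split_ifs <;> simp
    refine MPCRuns.single ?_ ⟨?_, ?_⟩ rfl ?_
    · intro i
      exact (Λ.simConfig_length f h
        (fun s q => Nat.le_floor ((hgood s).1.1 T le_rfl q)) i).trans hS
    · intro i
      by_cases hi : ∃ s, i = Λ.slot (s, h' s, Fin.last L)
      · obtain ⟨s, rfl⟩ := hi
        refine (sum_length_le _ {Λ.root s, Λ.root (h' s)} 1 (fun j _ => hlen _ j) ?_).trans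
          ((Nat.mul_le_mul_right 1 Finset.card_le_two).trans (by omega))
        intro j hj
        by_contra hne
        apply hj
        simpa using ((hsend_slot _ _ _).1 hne).2
      · rw [Finset.sum_eq_zero]
        · exact Nat.zero_le _
        · intro j _
          rw [hsend, if_neg fun hh => hi ⟨hh.choose, hh.choose_spec.1⟩, List.length_nil]
    · intro j
      by_cases hj : ∃ y, j = Λ.root y
      · obtain ⟨y, rfl⟩ := hj
        refine (sum_length_le _ {Λ.slot (y, h' y, Fin.last L),
          Λ.slot (h'.symm y, y, Fin.last L)} 1 (fun i _ => hlen i _) ?_).trans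
          ((Nat.mul_le_mul_right 1 Finset.card_le_two).trans (by omega))
        intro i hi
        rw [hsend, if_neg]
        rintro ⟨s, rfl, hs | hs⟩
        · obtain rfl := Λ.root_injective hs
          simp at hi
        · obtain rfl := Λ.root_injective hs
          simp at hi
      · rw [Finset.sum_eq_zero]
        · exact Nat.zero_le _
        · intro i _
          rw [hsend, if_neg, List.length_nil]
          rintro ⟨s, -, hs | hs⟩
          · exact hj ⟨_, hs⟩
          · exact hj ⟨_, hs⟩
    · intro i
      simp only [MPCRound.step, returnRound, List.length_append, List.length_drop,
        List.length_take, List.length_cons, List.length_nil]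
      omega

variable (A ω) in
/-- The rounds of a phase; `Rs` are the rounds of the broadcast at its end. -/
noncomputable def phaseRounds (T l a : ℕ) (Rs : List (MPCRound M)) : List (MPCRound M) :=
  Λ.loadRound A ω l a :: ((List.range T).map (Λ.simRound A ω) ++ ([Λ.returnRound A ω l a] ++ Rs))

theorem phaseRounds_length (T l a : ℕ) (Rs : List (MPCRound M)) :
    (Λ.phaseRounds A ω T l a Rs).length = T + 2 + Rs.length := by
  simp [phaseRounds]
  omega

/-- A phase replaces `h` by `f ^ a * h ^ l`. -/
theorem phaseRounds_runs {k T S B : ℕ} {S' : ℝ} {f h : Equiv.Perm X} {l a : ℕ} (hL : 0 < L)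
    (hla : l + a ≤ L) (hgood : ∀ s, Λ.GoodSeed A ω k T S' f h l a s) (hS : 4 + ⌊S'⌋₊ ≤ S)
    {Rs : List (MPCRound M)} (hRs : ∀ (S w : ℕ) (c : MPCConfig M), (∀ i, (c i).length ≤ w) →
      B * w ≤ S → MPCRuns S Rs c (c ∘ fun i => Λ.root (Λ.elt i))) (hB : B * 4 ≤ S) :
    MPCRuns S (Λ.phaseRounds A ω T l a Rs) (Λ.ready f h) (Λ.ready f (f ^ a * h ^ l)) := by
  obtain ⟨c, hc4, hc, hret⟩ := Λ.returnRound_runs hL hla hgood hS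
  have hbc := hRs S 4 c hc4 hB
  have hfinal : (c ∘ fun i => Λ.root (Λ.elt i)) = Λ.ready f (f ^ a * h ^ l) := by
    funext i
    exact hc _
  rw [hfinal] at hbc
  refine MPCRuns.cons _ _ _ _ ?_ (MPCRound.loc_fits _ _ _) ?_
  · intro i
    exact le_trans (le_of_eq (Λ.side_length _ _ _)) (by omega)
  · rw [Λ.loadRound_step]
    exact (Λ.simRounds_runs f h hS fun s => (hgood s).1).append (hret.append hbc)

end Return

end SimLayout

/-! ### Collecting the neighborhoods -/

section Setup

variable {n M : ℕ} (pair : Fin n × Fin n ↪ Fin M)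

/-- A set of half-edges as a list of words, one word for every half-edge. -/
noncomputable def encodeEdges (P : Finset (Fin n × Fin n)) : List (Fin M) := P.toList.map pair

/-- The set of half-edges in a memory. -/
def decodeEdges (mem : List (Fin M)) : Finset (Fin n × Fin n) :=
  Finset.univ.filter fun p => pair p ∈ mem

@[simp]
theorem decodeEdges_encodeEdges (P : Finset (Fin n × Fin n)) :
    decodeEdges pair (encodeEdges pair P) = P := by
  ext p
  simp [decodeEdges, encodeEdges]

@[simp]
theorem decodeEdges_nil : decodeEdges pair [] = ∅ := by
  simp [decodeEdges]

@[simp]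
theorem encodeEdges_length (P : Finset (Fin n × Fin n)) :
    (encodeEdges pair P).length = P.card := by
  simp [encodeEdges]

end Setup

open Classical in
/-- The half-edges of `G` at the vertices `v` with `κ v = j`. -/
noncomputable def edgesAt {n M : ℕ} (G : SimpleGraph (Fin n)) (κ : Fin n → Fin M) (j : Fin M) :
    Finset (Fin n × Fin n) :=
  Finset.univ.filter fun p => κ p.1 = j ∧ G.Adj p.1 p.2

open Classical in
/-- The half-edges at the vertices `v` with `κ v = j` and at their neighbors. -/
noncomputable def edgesNear {n M : ℕ} (G : SimpleGraph (Fin n)) (κ : Fin n → Fin M)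
    (j : Fin M) : Finset (Fin n × Fin n) :=
  edgesAt G κ j ∪ (edgesAt G κ j).biUnion fun q => edgesAt G κ (κ q.2)

section Edges

variable {n M : ℕ} {G G' : SimpleGraph (Fin n)} {κ : Fin n → Fin M}

@[simp]
theorem mem_edgesAt {j : Fin M} {p : Fin n × Fin n} :
    p ∈ edgesAt G κ j ↔ κ p.1 = j ∧ G.Adj p.1 p.2 := by
  simp [edgesAt]

theorem mem_edgesNear {j : Fin M} {p : Fin n × Fin n} :
    p ∈ edgesNear G κ j ↔ p ∈ edgesAt G κ j ∨ ∃ q ∈ edgesAt G κ j, p ∈ edgesAt G κ (κ q.2) := by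
  simp [edgesNear]

theorem card_edgesAt_le (hG : TwoRegular G) (hκ : Function.Injective κ) (j : Fin M) :
    (edgesAt G κ j).card ≤ 2 := by
  by_cases hj : ∃ v, κ v = j
  · obtain ⟨v, rfl⟩ := hj
    rw [← hG v, Set.ncard_eq_toFinset_card _ (Set.toFinite _)]
    refine Finset.card_le_card_of_injOn Prod.snd ?_ ?_
    · rintro ⟨x, y⟩ h
      obtain ⟨h1, h2⟩ := mem_edgesAt.1 h
      obtain rfl := hκ h1
      simpa using h2
    · rintro ⟨x, y⟩ h ⟨x', y'⟩ h' (rfl : y = y')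
      have h1 := (mem_edgesAt.1 h).1
      have h2 := (mem_edgesAt.1 h').1
      exact Prod.ext (hκ (h1.trans h2.symm)) rfl
  · rw [Finset.card_eq_zero.2]
    · exact Nat.zero_le _
    · ext p
      simp only [mem_edgesAt, Finset.notMem_empty, iff_false]
      exact fun h => hj ⟨_, h.1⟩

theorem card_edgesNear_le (hG : TwoRegular G) (hκ : Function.Injective κ) (j : Fin M) :
    (edgesNear G κ j).card ≤ 6 := by
  classical
  have h1 := card_edgesAt_le hG hκ j
  have h2 := Finset.card_biUnion_le_card_mul (edgesAt G κ j) (fun q => edgesAt G κ (κ q.2)) 2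
    fun q _ => card_edgesAt_le hG hκ _
  have h3 : (edgesNear G κ j).card ≤ _ := Finset.card_union_le _ _
  convert h3.trans (Nat.add_le_add h1 (h2.trans (Nat.mul_le_mul_right 2 h1)))

theorem nextDart_congr_of_edgesNear (hG : TwoRegular G) (hG' : TwoRegular G')
    {v : Fin n} (h : edgesNear G κ (κ v) = edgesNear G' κ (κ v))
    (b : Bool) : nextDart hG (v, b) = nextDart hG' (v, b) ∧
      (nextDart hG).symm (v, b) = (nextDart hG').symm (v, b) := by
  have hadj : ∀ {G : SimpleGraph (Fin n)} {p}, p ∈ edgesNear G κ (κ v) → G.Adj p.1 p.2 := by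
    intro G p hp
    rcases mem_edgesNear.1 hp with hp | ⟨q, -, hp⟩
    · exact (mem_edgesAt.1 hp).2
    · exact (mem_edgesAt.1 hp).2
  have hself : ∀ {G : SimpleGraph (Fin n)} {u}, G.Adj v u → (v, u) ∈ edgesNear G κ (κ v) :=
    fun h => mem_edgesNear.2 (Or.inl (mem_edgesAt.2 ⟨rfl, h⟩))
  have hnear : ∀ {G : SimpleGraph (Fin n)} {u w}, G.Adj v u → G.Adj u w →
      (u, w) ∈ edgesNear G κ (κ v) := fun {_ u _} h h' =>
    mem_edgesNear.2 (Or.inr ⟨(v, u), mem_edgesAt.2 ⟨rfl, h⟩, mem_edgesAt.2 ⟨rfl, h'⟩⟩)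
  have hv : ∀ u, G.Adj v u ↔ G'.Adj v u := fun u =>
    ⟨fun hu => hadj (h ▸ hself hu), fun hu => hadj (h.symm ▸ hself hu)⟩
  refine nextDart_congr hG hG' (Set.ext hv) (fun u hu => Set.ext fun w => ⟨fun hw => ?_,
    fun hw => ?_⟩) b
  · exact hadj (h ▸ hnear hu hw)
  · exact hadj (h.symm ▸ hnear ((hv u).1 hu) hw)

end Edges

/-- Collect the half-edges of every node `v` at the machine `κ v`. -/
noncomputable def distributeRound {n M : ℕ} (pair : Fin n × Fin n ↪ Fin M) (κ : Fin n → Fin M) :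
    MPCRound M where
  send _ mem j := encodeEdges pair ((decodeEdges pair mem).filter fun p => κ p.1 = j)
  update _ _ msgs := encodeEdges pair (Finset.univ.biUnion fun i => decodeEdges pair (msgs i))

/-- Exchange the half-edges between neighbors. -/
noncomputable def exchangeRound {n M : ℕ} (pair : Fin n × Fin n ↪ Fin M) (κ : Fin n → Fin M) :
    MPCRound M where
  send _ mem j := if ∃ p ∈ decodeEdges pair mem, κ p.2 = j then mem else []
  update _ mem msgs := encodeEdges pair
    (decodeEdges pair mem ∪ Finset.univ.biUnion fun i => decodeEdges pair (msgs i))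

/-- The half-edges in a local input. -/
noncomputable def loadEdges {n M : ℕ} (pair : Fin n × Fin n ↪ Fin M) (x : LocalInput n Unit) :
    List (Fin M) :=
  encodeEdges pair (Set.toFinite {p | (p.1, p.2, ()) ∈ x.halfEdges}).toFinset

section SetupRuns

variable {n M S : ℕ} {G : SimpleGraph (Fin n)} {pair : Fin n × Fin n ↪ Fin M}
  {κ : Fin n → Fin M}

theorem loadEdges_localInput (gin : HalfEdgeLabeling G Unit) (host : Fin n → Fin M) (i : Fin M) :
    loadEdges pair (localInput gin host i) = encodeEdges pair (edgesAt G host i) := by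
  unfold loadEdges
  congr 1
  ext ⟨v, u⟩
  rw [Set.Finite.mem_toFinset, mem_edgesAt]
  constructor
  · rintro ⟨d, hd, h⟩
    obtain ⟨rfl, h⟩ := Prod.mk.inj h
    obtain ⟨rfl, -⟩ := Prod.mk.inj h
    exact ⟨hd, d.adj⟩
  · rintro ⟨hv, h⟩
    exact ⟨⟨(v, u), h⟩, hv, rfl⟩

theorem card_edgesAt_le_size (gin : HalfEdgeLabeling G Unit) (host : Fin n → Fin M) (i : Fin M) :
    (edgesAt G host i).card ≤ (localInput gin host i).size := by
  have h1 : (edgesAt G host i).card ≤ (localInput gin host i).halfEdges.ncard := by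
    rw [← Set.ncard_coe_finset]
    refine Set.ncard_le_ncard_of_injOn (fun p => (p.1, p.2, ())) ?_ ?_ (Set.toFinite _)
    · rintro ⟨v, u⟩ h
      obtain ⟨hv, h⟩ := mem_edgesAt.1 h
      exact ⟨⟨(v, u), h⟩, hv, rfl⟩
    · rintro ⟨v, u⟩ - ⟨v', u'⟩ - h
      simpa using h
  unfold LocalInput.size
  omega

theorem distributeRound_runs (hG : TwoRegular G) (hκ : Function.Injective κ)
    {host : Fin n → Fin M} (hS : ∀ i, (edgesAt G host i).card ≤ S) (hS2 : 2 ≤ S) :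
    MPCRuns S [distributeRound pair κ] (fun i => encodeEdges pair (edgesAt G host i))
      (fun j => encodeEdges pair (edgesAt G κ j)) := by
  classical
  have hsend : ∀ i j, (distributeRound pair κ).send i (encodeEdges pair (edgesAt G host i)) j =
      encodeEdges pair ((edgesAt G host i).filter fun p => κ p.1 = j) := by
    intro i j
    simp only [distributeRound, decodeEdges_encodeEdges]
  have hsend' : ∀ i j, (edgesAt G host i).filter (fun p => κ p.1 = j) =
      (edgesAt G κ j).filter fun p => host p.1 = i := by
    intro i j
    ext p
    simp only [Finset.mem_filter, mem_edgesAt]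
    tauto
  refine MPCRuns.single (by simpa using hS) ⟨?_, ?_⟩ ?_
    fun i => by simpa using (card_edgesAt_le hG hκ i).trans hS2
  · intro i
    simp only [hsend, encodeEdges_length]
    rw [← Finset.card_eq_sum_card_fiberwise fun _ _ => Finset.mem_coe.2 (Finset.mem_univ _)]
    exact hS i
  · intro j
    simp only [hsend, encodeEdges_length, hsend']
    rw [← Finset.card_eq_sum_card_fiberwise fun _ _ => Finset.mem_coe.2 (Finset.mem_univ _)]
    exact (card_edgesAt_le hG hκ j).trans hS2
  · funext j
    change encodeEdges pair (Finset.univ.biUnion fun i => decodeEdges pair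
      ((distributeRound pair κ).send i (encodeEdges pair (edgesAt G host i)) j)) = _
    congr 1
    ext p
    simp only [hsend, hsend', decodeEdges_encodeEdges, Finset.mem_biUnion, Finset.mem_univ,
      true_and, Finset.mem_filter]
    exact ⟨fun ⟨i, h, _⟩ => h, fun h => ⟨_, h, rfl⟩⟩

theorem exchangeRound_runs (hG : TwoRegular G) (hκ : Function.Injective κ) (hS : 6 ≤ S) :
    MPCRuns S [exchangeRound pair κ] (fun j => encodeEdges pair (edgesAt G κ j))
      (fun j => encodeEdges pair (edgesNear G κ j)) := by
  classical
  have hsend : ∀ i j, (exchangeRound pair κ).send i (encodeEdges pair (edgesAt G κ i)) j =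
      if ∃ p ∈ edgesAt G κ i, κ p.2 = j then encodeEdges pair (edgesAt G κ i) else [] := by
    intro i j
    simp only [exchangeRound, decodeEdges_encodeEdges]
  have hsymm : ∀ i j, (∃ p ∈ edgesAt G κ i, κ p.2 = j) ↔ ∃ p ∈ edgesAt G κ j, κ p.2 = i := by
    intro i j
    constructor
    all_goals
      rintro ⟨p, hp, rfl⟩
      obtain ⟨rfl, hadj⟩ := mem_edgesAt.1 hp
      exact ⟨(p.2, p.1), mem_edgesAt.2 ⟨rfl, hadj.symm⟩, rfl⟩
  have hlen : ∀ i j, ((exchangeRound pair κ).send i (encodeEdges pair (edgesAt G κ i)) j).length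
      ≤ 2 := by
    intro i j
    rw [hsend]
    split_ifs
    · simpa using card_edgesAt_le hG hκ i
    · simp
  have hcard : ∀ i, ((edgesAt G κ i).image fun p => κ p.2).card * 2 ≤ S := fun i =>
    (Nat.mul_le_mul_right 2 (Finset.card_image_le.trans (card_edgesAt_le hG hκ i))).trans
      (by omega)
  refine MPCRuns.single (fun i => ?_) ⟨?_, ?_⟩ ?_ fun i => ?_
  · have := card_edgesAt_le hG hκ i
    simp only [encodeEdges_length]
    omega
  · intro i
    refine (sum_length_le _ ((edgesAt G κ i).image fun p => κ p.2) 2 (fun j _ => hlen i j)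
      fun j hj => ?_).trans (hcard i)
    rw [hsend, if_neg]
    rintro ⟨p, hp, rfl⟩
    exact hj (Finset.mem_image_of_mem _ hp)
  · intro j
    refine (sum_length_le _ ((edgesAt G κ j).image fun p => κ p.2) 2 (fun i _ => hlen i j)
      fun i hi => ?_).trans (hcard j)
    rw [hsend, if_neg]
    rw [hsymm]
    rintro ⟨p, hp, rfl⟩
    exact hi (Finset.mem_image_of_mem _ hp)
  · funext j
    change encodeEdges pair (decodeEdges pair (encodeEdges pair (edgesAt G κ j)) ∪
      Finset.univ.biUnion fun i => decodeEdges pair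
        ((exchangeRound pair κ).send i (encodeEdges pair (edgesAt G κ i)) j)) = _
    congr 1
    ext p
    simp only [hsend, hsymm _ j, decodeEdges_encodeEdges, Finset.mem_union, Finset.mem_biUnion,
      Finset.mem_univ, true_and, mem_edgesNear]
    refine or_congr_right ⟨?_, ?_⟩
    · rintro ⟨i, hp⟩
      split_ifs at hp with hq
      · obtain ⟨q, hq, rfl⟩ := hq
        rw [decodeEdges_encodeEdges] at hp
        exact ⟨q, hq, hp⟩
      · simp at hp
    · rintro ⟨q, hq, hp⟩
      refine ⟨κ q.2, ?_⟩
      rw [if_pos ⟨q, hq, rfl⟩, decodeEdges_encodeEdges]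
      exact hp
  · simpa using (card_edgesNear_le hG hκ i).trans hS

end SetupRuns

namespace SimLayout

variable {n L N K M : ℕ} (Λ : SimLayout (Fin n × Bool) L N K M) (pair : Fin n × Fin n ↪ Fin M)

/-- The machine that collects the half-edges at `v`. -/
def collector (v : Fin n) : Fin M := Λ.root (v, false)

theorem collector_injective : Function.Injective Λ.collector := fun _ _ h =>
  (Prod.mk.inj (Λ.root_injective h)).1

/-- Every machine computes the next and the previous dart, by taking any 2-regular graph that
agrees with the known half-edges. -/
noncomputable def extractRound : MPCRound M :=
  open Classical in
  .loc fun i mem =>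
    if h : ∃ G : {G : SimpleGraph (Fin n) // TwoRegular G},
      mem = encodeEdges pair (edgesNear G.1 Λ.collector (Λ.collector (Λ.elt i).1)) then
      Λ.side (nextDart h.choose.2) 1 (Λ.elt i) else []

theorem extractRound_step {G : SimpleGraph (Fin n)} (hG : TwoRegular G) :
    (Λ.extractRound pair).step (fun i => encodeEdges pair
      (edgesNear G Λ.collector (Λ.collector (Λ.elt i).1))) = Λ.ready (nextDart hG) 1 := by
  funext i
  have hex : ∃ G' : {G : SimpleGraph (Fin n) // TwoRegular G},
      encodeEdges pair (edgesNear G Λ.collector (Λ.collector (Λ.elt i).1)) =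
        encodeEdges pair (edgesNear G'.1 Λ.collector (Λ.collector (Λ.elt i).1)) := ⟨⟨G, hG⟩, rfl⟩
  simp only [MPCRound.step, extractRound, MPCRound.loc]
  rw [dif_pos hex]
  have h1 := congrArg (decodeEdges pair) hex.choose_spec
  rw [decodeEdges_encodeEdges, decodeEdges_encodeEdges] at h1
  obtain ⟨h2, h3⟩ := nextDart_congr_of_edgesNear hG hex.choose.2 h1
    (Λ.elt i).2
  simp only [ready, side]
  rw [show ((Λ.elt i).1, (Λ.elt i).2) = Λ.elt i from rfl] at h2 h3
  rw [h2, h3]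

/-- The rounds before the first phase; `Rs` are the rounds of a broadcast. -/
noncomputable def setupRounds (Rs : List (MPCRound M)) : List (MPCRound M) :=
  [distributeRound pair Λ.collector] ++ ([exchangeRound pair Λ.collector] ++
    (Rs ++ [Λ.extractRound pair]))

theorem setupRounds_runs {G : SimpleGraph (Fin n)} (hG : TwoRegular G)
    {gin : HalfEdgeLabeling G Unit} {host : Fin n → Fin M} {S B : ℕ}
    (hS : ∀ i, (localInput gin host i).size ≤ S) (hS6 : 6 ≤ S) {Rs : List (MPCRound M)}
    (hRs : ∀ (S w : ℕ) (c : MPCConfig M), (∀ i, (c i).length ≤ w) →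
      B * w ≤ S → MPCRuns S Rs c (c ∘ fun i => Λ.collector (Λ.elt i).1)) (hB : B * 6 ≤ S) :
    MPCRuns S (Λ.setupRounds pair Rs) (fun i => loadEdges pair (localInput gin host i))
      (Λ.ready (nextDart hG) 1) := by
  simp only [loadEdges_localInput]
  have hκ := Λ.collector_injective
  have h6 : ∀ i, (encodeEdges pair (edgesNear G Λ.collector i)).length ≤ 6 := fun i => by
    simpa using card_edgesNear_le hG hκ i
  refine (distributeRound_runs hG hκ (fun i => (card_edgesAt_le_size gin host i).trans (hS i))
    (by omega)).append ((exchangeRound_runs hG hκ hS6).append ((hRs S 6 _ h6 hB).append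
    (MPCRuns.single (fun i => (h6 _).trans hS6) (MPCRound.loc_fits _ _ _)
      (Λ.extractRound_step pair hG) fun i => ?_)))
  exact le_trans (le_of_eq (Λ.side_length _ _ _)) (by omega)

end SimLayout

/-! ### The reduction for fixed parameters -/

theorem localInput_size_le_of_injective {n M : ℕ} {I : Type} {G : SimpleGraph (Fin n)}
    (hG : MaxDegreeLE G 2) (gin : HalfEdgeLabeling G I) {host : Fin n → Fin M}
    (hhost : Function.Injective host) (i : Fin M) : (localInput gin host i).size ≤ 7 := by
  have h1 : (localInput gin host i).nodes.ncard ≤ 1 :=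
    (Set.ncard_le_one (Set.toFinite _)).2 fun a ha b hb => hhost (ha.trans hb.symm)
  have h2 : (localInput gin host i).halfEdges.ncard ≤ 2 := by
    by_cases hi : ∃ v, host v = i
    · obtain ⟨v, rfl⟩ := hi
      refine le_trans ?_ (hG v)
      refine Set.ncard_le_ncard_of_injOn (fun x => x.2.1) ?_ ?_ (Set.toFinite _)
      · rintro _ ⟨d, hd, rfl⟩
        rw [← hhost hd]
        exact d.adj
      · rintro _ ⟨d, hd, rfl⟩ _ ⟨d', hd', rfl⟩ h
        have : d = d' := by
          refine SimpleGraph.Dart.ext _ _ (Prod.ext ?_ h)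
          exact hhost (hd.trans hd'.symm)
        rw [this]
    · have : (localInput gin host i).halfEdges = ∅ := by
        rw [Set.eq_empty_iff_forall_notMem]
        rintro _ ⟨d, hd, rfl⟩
        exact hi ⟨_, hd⟩
      rw [this]
      simp
  unfold LocalInput.size
  omega

/-- The union bound for events of a finite uniform probability space. -/
theorem one_sub_card_mul_le_of_forall {Ω ι : Type} [Finite Ω] [Nonempty Ω] [Fintype ι]
    (Q : ι → Ω → Prop) {p : ℝ}
    (h : ∀ i, 1 - p ≤ (Nat.card {ω // Q i ω} : ℝ) / Nat.card Ω) :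
    1 - Fintype.card ι * p ≤ (Nat.card {ω // ∀ i, Q i ω} : ℝ) / Nat.card Ω := by
  classical
  have := Fintype.ofFinite Ω
  have hpos : (0 : ℝ) < Nat.card Ω := by exact_mod_cast Nat.card_pos
  have hbad : ∀ i, ((Finset.univ.filter fun ω => ¬ Q i ω).card : ℝ) ≤ p * Nat.card Ω := by
    intro i
    have h1 := h i
    rw [le_div_iff₀ hpos, Nat.card_eq_fintype_card (α := {ω // Q i ω}),
      Fintype.card_subtype] at h1
    have h2 : ((Finset.univ.filter fun ω => Q i ω).card : ℝ) +
        (Finset.univ.filter fun ω => ¬ Q i ω).card = Nat.card Ω := by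
      rw [Nat.card_eq_fintype_card, ← Finset.card_univ]
      exact_mod_cast Finset.card_filter_add_card_filter_not _
    linarith
  have hcover : (Finset.univ : Finset Ω) ⊆ (Finset.univ.filter fun ω => ∀ i, Q i ω) ∪
      Finset.univ.biUnion fun i => Finset.univ.filter fun ω => ¬ Q i ω := by
    intro ω _
    by_cases hω : ∀ i, Q i ω
    · exact Finset.mem_union_left _ (by simpa using hω)
    · exact Finset.mem_union_right _ (by simpa using hω)
  have h1 := (Finset.card_le_card hcover).trans
    ((Finset.card_union_le _ _).trans (Nat.add_le_add_left Finset.card_biUnion_le _))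
  have h2 : (Nat.card Ω : ℝ) ≤ (Finset.univ.filter fun ω => ∀ i, Q i ω).card +
      ∑ i, ((Finset.univ.filter fun ω => ¬ Q i ω).card : ℝ) := by
    rw [Nat.card_eq_fintype_card, ← Finset.card_univ]
    exact_mod_cast h1
  have h3 : ∑ i, ((Finset.univ.filter fun ω => ¬ Q i ω).card : ℝ) ≤
      Fintype.card ι * (p * Nat.card Ω) := by
    refine (Finset.sum_le_sum fun i _ => hbad i).trans ?_
    simp
  rw [le_div_iff₀ hpos, Nat.card_eq_fintype_card (α := {ω // ∀ i, Q i ω}), Fintype.card_subtype]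
  nlinarith

theorem MPCProgram.le_successProb_ofRounds {n M : ℕ} {I Res : Type} {Seed : Type}
    {hfin : Finite Seed} {hne : Nonempty Seed} {load : Fin M → LocalInput n I → List (Fin M)}
    {prot : Seed → List (MPCRound M)} {out : Fin M → List (Fin M) → Res} {S T : ℕ} {S' : ℝ}
    (hS : (S : ℝ) ≤ S') (hT : ∀ ω, (prot ω).length = T) {x : Fin M → LocalInput n I}
    {Q : Seed → Prop} {ok : (Fin M → Res) → Prop}
    (h : ∀ ω, Q ω → ∃ c, MPCRuns S (prot ω) (fun i => load i (x i)) c ∧ ok fun i => out i (c i)) :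
    (Nat.card {ω // Q ω} : ℝ) / Nat.card Seed ≤
      (ofRounds Seed hfin hne load prot out).successProb x T S' ok := by
  refine div_le_div_of_nonneg_right (Nat.cast_le.2 ?_) (Nat.cast_nonneg _)
  have : Finite (ofRounds Seed hfin hne load prot out).Seed := hfin
  refine Nat.card_le_card_of_injective (Subtype.map id fun ω hω => ?_)
    (Subtype.map_injective _ Function.injective_id)
  obtain ⟨c, hc, hok⟩ := h ω hω
  obtain ⟨h1, h2⟩ := ofRounds_spec (hfin := hfin) (hne := hne) (out := out) hS hc
  rw [hT] at h1 h2
  exact ⟨h1, h2 ▸ hok⟩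

/-- The exponents `m / l ^ (P - j)`: each is obtained from the previous one by appending a digit in
base `l`, and the last one, for `j = P`, is `m`. -/
theorem digits_step (m l P j : ℕ) (hj : j < P) :
    m / l ^ (P - (j + 1)) % l + m / l ^ (P - j) * l = m / l ^ (P - (j + 1)) := by
  have h1 : P - j = P - (j + 1) + 1 := by omega
  rw [h1, pow_succ, ← Nat.div_div_eq_div_mul, mul_comm]
  exact Nat.mod_add_div _ _

/-- A program `A` for path orientations on forests with `N` nodes and diameter at most `2 * l`
yields a program that distinguishes one cycle on `n` nodes from two, in `P` phases that simulate
`A`. -/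
theorem exists_cycles_program {n N K M k l P T B d S : ℕ} {SA SB p : ℝ}
    (Λ : SimLayout (Fin n × Bool) (2 * l) N K M) (pair : Fin n × Fin n ↪ Fin M)
    (A : MPCProgram N K Bool (Fin N → Fin N → EdgeStatus))
    (hA : ∀ (G : SimpleGraph (Fin N)) (gin : HalfEdgeLabeling G Bool), G.IsAcyclic →
      MaxDegreeLE G 2 → ComponentDiamLE G (2 * l) → ∀ host : Fin N → Fin K,
      (∀ i, (localInput gin host i).size ≤ 7) →
      1 - p ≤ A.successProb (localInput gin host) T SA fun res =>
        (pathOrientation k).IsSolution gin fun d => res (host d.fst) d.fst d.snd)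
    (hl : 0 < l) (hP : n < l ^ P) (hSA : 4 + ⌊SA⌋₊ ≤ S) (hB : 0 < B) (hBS : B * 6 ≤ S)
    (hSB : (S : ℝ) ≤ SB) (hM : M ≤ B ^ d) :
    ∃ C : MPCProgram n M Unit Prop, ∀ (G : SimpleGraph (Fin n)) (gin : HalfEdgeLabeling G Unit),
      IsOneCycle G ∨ IsTwoCycles G → ∀ host : Fin n → Fin M,
      (∀ i, (localInput gin host i).size ≤ S) →
      1 - P * (2 * n) * p ≤ C.successProb (localInput gin host)
        ((3 + d) + P * (T + 2 + d) + d) SB fun res => ∀ i, res i ↔ IsOneCycle G := by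
  obtain ⟨Rs₀, hlen₀, hRs₀⟩ := exists_broadcast (fun i => Λ.collector (Λ.elt i).1)
    (fun i => by simp [SimLayout.collector]) hB hM
  obtain ⟨Rs₁, hlen₁, hRs₁⟩ := exists_broadcast (fun i => Λ.root (Λ.elt i))
    (fun i => by simp) hB hM
  obtain ⟨Rs₂, hlen₂, hRs₂⟩ := exists_broadcast (fun _ => Λ.root Λ.base)
    (fun i => rfl) hB hM
  obtain ⟨e, he⟩ : ∃ e : ℕ → ℕ, ∀ j, e j = n / 2 / l ^ (P - j) := ⟨_, fun _ => rfl⟩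
  let prot : A.Seed → List (MPCRound M) := fun ω => Λ.setupRounds pair Rs₀ ++
    (((List.range P).flatMap fun j => Λ.phaseRounds A ω T l (e (j + 1) % l) Rs₁) ++ Rs₂)
  have hprot : ∀ ω, (prot ω).length = (3 + d) + P * (T + 2 + d) + d := by
    intro ω
    simp only [prot, SimLayout.setupRounds, List.length_append, List.length_flatMap,
      SimLayout.phaseRounds_length, List.length_cons, List.length_nil, hlen₀, hlen₁, hlen₂,
      List.map_const', List.sum_replicate, List.length_range, smul_eq_mul]
    omega
  refine ⟨MPCProgram.ofRounds A.Seed A.finite_seed A.nonempty_seed (fun _ => loadEdges pair) prot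
    (fun _ mem => mem.head? ≠ some (Λ.word Λ.base)), fun G gin hcyc host hsize => ?_⟩
  have hG := twoRegular_of_cycles hcyc
  have := A.finite_seed
  have := A.nonempty_seed
  -- the inputs to `A` in all phases and copies are determined by `G`
  have hgood := one_sub_card_mul_le_of_forall (Ω := A.Seed) (ι := Fin P × (Fin n × Bool))
    (fun i ω => Λ.GoodSeed A ω k T SA (nextDart hG) (nextDart hG ^ e i.1) l (e (i.1 + 1) % l) i.2)
    (p := p) fun i => hA _ _ layeredGraph.isAcyclic layeredGraph.maxDegreeLE_two
      layeredGraph.componentDiamLE Λ.host fun q =>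
        localInput_size_le_of_injective layeredGraph.maxDegreeLE_two _ Λ.host.injective q
  have hcard : (Fintype.card (Fin P × (Fin n × Bool)) : ℝ) = P * (2 * n) := by
    simp only [Fintype.card_prod, Fintype.card_fin, Fintype.card_bool]
    push_cast
    ring
  rw [hcard] at hgood
  refine hgood.trans (MPCProgram.le_successProb_ofRounds hSB (hprot) fun ω hω => ?_)
  have hl2 : ∀ j, l + e (j + 1) % l ≤ 2 * l := fun j => by
    have := Nat.mod_lt (e (j + 1)) hl
    omega
  have hphases : MPCRuns S
      ((List.range P).flatMap fun j => Λ.phaseRounds A ω T l (e (j + 1) % l) Rs₁)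
      (Λ.ready (nextDart hG) (nextDart hG ^ e 0)) (Λ.ready (nextDart hG) (nextDart hG ^ e P)) := by
    refine MPCRuns.flatMap_range
      (c := fun j => Λ.ready (nextDart hG) (nextDart hG ^ e j)) ?_ P fun j hj => ?_
    · intro i
      exact le_trans (le_of_eq (Λ.side_length _ _ _)) (by omega)
    · have hg : ∀ s, Λ.GoodSeed A ω k T SA (nextDart hG) (nextDart hG ^ e j) l (e (j + 1) % l) s :=
        fun s => hω (⟨j, hj⟩, s)
      have h1 := Λ.phaseRounds_runs (by omega) (hl2 j) hg hSA hRs₁ (by omega)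
      have h2 : e (j + 1) % l + e j * l = e (j + 1) := by
        rw [he, he]
        exact digits_step (n / 2) l P j hj
      rw [← pow_mul, ← pow_add, h2] at h1
      exact h1
  have he0 : e 0 = 0 := by
    rw [he, Nat.sub_zero]
    exact Nat.div_eq_of_lt (by omega)
  have heP : e P = n / 2 := by simp [he]
  rw [he0, pow_zero, heP] at hphases
  refine ⟨Λ.ready (nextDart hG) (nextDart hG ^ (n / 2)) ∘ fun _ => Λ.root Λ.base,
    (Λ.setupRounds_runs pair hG hsize (by omega) hRs₀ hBS).append
      (hphases.append (hRs₂ S 4 _ (fun i => le_of_eq (Λ.side_length _ _ _)) (by omega))),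
    fun i => ?_⟩
  rw [← nextDart_pow_ne_self_iff hcyc hG Λ.base]
  simp [SimLayout.ready, SimLayout.side]

/-! ### Choice of the parameters -/

theorem SimLayout.nonempty_of_le {n l N K M : ℕ} (hn : 0 < n) (hN : 2 * n * (2 * l + 1) ≤ N)
    (hK : N ≤ K) (hM : 2 * n * K ≤ M) :
    Nonempty (SimLayout (Fin n × Bool) (2 * l) N K M) := by
  have hKM : K ≤ M := (Nat.le_mul_of_pos_left K (by omega)).trans hM
  have hNpos : 0 < K := lt_of_lt_of_le (Nat.mul_pos (by omega) (by omega)) (hN.trans hK)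
  have hXM : 2 * n ≤ M := (Nat.le_mul_of_pos_right (2 * n) hNpos).trans hM
  obtain ⟨code⟩ : Nonempty ((Fin n × Bool) × Fin (2 * l + 1) ↪ Fin N) :=
    Function.Embedding.nonempty_of_card_le (by
      simpa [mul_comm n 2] using hN)
  obtain ⟨machine⟩ : Nonempty ((Fin n × Bool) × Fin K ↪ Fin M) :=
    Function.Embedding.nonempty_of_card_le (by
      simpa [mul_comm n 2] using hM)
  obtain ⟨word⟩ : Nonempty ((Fin n × Bool) ↪ Fin M) :=
    Function.Embedding.nonempty_of_card_le (by
      simpa [mul_comm n 2] using hXM)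
  exact ⟨⟨code, Fin.castLEEmb hK, machine, Fin.castLEEmb hKM, word, (⟨0, hn⟩, false)⟩⟩

/-- The number of rounds of the reduction is `o (log n)`: there are `O (log n / log D)` phases, and
each of them takes `o (log D)` rounds. -/
theorem reduction_rounds_isLittleO {T D N : ℕ → ℕ} (hN : Tendsto N atTop atTop)
    (hT : (fun n => (T n : ℝ)) =o[atTop] fun n => Real.log (D n)) (hD : Tendsto D atTop atTop)
    (hDN : ∀ᶠ n in atTop, D (N n) ≤ n) (d : ℕ) :
    (fun n => ((3 + d + (Nat.log (D (N n) / 2) n + 1) * (T (N n) + 2 + d) + d : ℕ) : ℝ))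
      =o[atTop] fun n : ℕ => Real.log n := by
  have hlogn : Tendsto (fun n : ℕ => Real.log n) atTop atTop :=
    Real.tendsto_log_atTop.comp tendsto_natCast_atTop_atTop
  have hconst : ∀ a : ℝ, (fun _ : ℕ => a) =o[atTop] fun n : ℕ => Real.log n := fun a =>
    isLittleO_const_left.2 (Or.inr (tendsto_norm_atTop_atTop.comp hlogn))
  have hDN' : Tendsto (fun n => D (N n)) atTop atTop := hD.comp hN
  have hlogD : Tendsto (fun n => Real.log (D (N n))) atTop atTop :=
    hlogn.comp hDN'
  have h1 : (fun n => ((T (N n) + 2 + d : ℕ) : ℝ)) =o[atTop] fun n => Real.log (D (N n)) := by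
    have h2 : (fun _ : ℕ => ((2 + d : ℕ) : ℝ)) =o[atTop] fun n => Real.log (D (N n)) :=
      isLittleO_const_left.2 (Or.inr (tendsto_norm_atTop_atTop.comp hlogD))
    refine ((hT.comp_tendsto hN).add h2).congr_left fun n => ?_
    simp only [Function.comp_apply]
    push_cast
    ring
  have h2 : (fun n => ((Nat.log (D (N n) / 2) n + 1 : ℕ) : ℝ) * Real.log (D (N n)))
      =O[atTop] fun n : ℕ => Real.log n := by
    refine IsBigO.of_bound 4 ?_
    filter_upwards [hDN'.eventually_ge_atTop 6, hDN, eventually_ge_atTop 1] with n h6 hle hn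
    set l := D (N n) / 2 with hl
    have hl3 : 3 ≤ l := by omega
    have hlR : (3 : ℝ) ≤ l := by exact_mod_cast hl3
    have hlog_l : 0 < Real.log l := Real.log_pos (by linarith)
    have hlog_n : 0 ≤ Real.log n := Real.log_natCast_nonneg n
    have hDl : Real.log (D (N n)) ≤ 2 * Real.log l := by
      have : (2 : ℝ) * Real.log l = Real.log ((l : ℝ) ^ 2) := by rw [Real.log_pow]; norm_num
      rw [this]
      apply Real.log_le_log
      · exact_mod_cast (by omega : 0 < D (N n))
      · have h7 : D (N n) ≤ 2 * l + 1 := by omega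
        have h8 : (D (N n) : ℝ) ≤ 2 * l + 1 := by exact_mod_cast h7
        nlinarith
    have hpow : (Nat.log l n : ℝ) * Real.log l ≤ Real.log n := by
      rw [← Real.log_pow]
      apply Real.log_le_log
      · positivity
      · exact_mod_cast Nat.pow_log_le_self l (by omega)
    have hln : Real.log l ≤ Real.log n := by
      apply Real.log_le_log (by linarith)
      exact_mod_cast (by omega : l ≤ n)
    have hlogD0 : 0 ≤ Real.log (D (N n)) := Real.log_natCast_nonneg _
    rw [Real.norm_of_nonneg (by positivity), Real.norm_of_nonneg hlog_n]
    calc ((Nat.log l n + 1 : ℕ) : ℝ) * Real.log (D (N n))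
        ≤ ((Nat.log l n + 1 : ℕ) : ℝ) * (2 * Real.log l) :=
          mul_le_mul_of_nonneg_left hDl (Nat.cast_nonneg _)
      _ = 2 * (Nat.log l n * Real.log l) + 2 * Real.log l := by push_cast; ring
      _ ≤ 4 * Real.log n := by linarith
  have h3 := ((isBigO_refl (fun n => ((Nat.log (D (N n) / 2) n + 1 : ℕ) : ℝ)) atTop).mul_isLittleO
    h1).trans_isBigO h2
  refine ((h3.add (hconst ((3 + d + d : ℕ) : ℝ)))).congr_left fun n => ?_
  push_cast
  ring

/-- The numbers that occur in the reduction are compatible with each other for all large `n`. -/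
theorem eventually_reduction_bounds {δ δ' C : ℝ} (hδ : 0 < δ) (hδδ' : δ < δ') (hC : 0 < C)
    {D : ℕ → ℕ} (hD : ∀ ε : ℝ, 0 < ε → ∀ᶠ n : ℕ in atTop, (D n : ℝ) ≤ (n : ℝ) ^ ε) :
    Tendsto (fun n : ℕ => ⌊(n : ℝ) ^ (δ' / δ)⌋₊) atTop atTop ∧
    ∀ᶠ n : ℕ in atTop, n ≤ ⌊(n : ℝ) ^ (δ' / δ)⌋₊ ∧
      ⌊(n : ℝ) ^ (δ' / δ)⌋₊ ≤ n ^ ⌈δ' / δ⌉₊ ∧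
      (⌊(n : ℝ) ^ (δ' / δ)⌋₊ : ℝ) ^ δ ≤ (n : ℝ) ^ δ' ∧
      7 ≤ C * (⌊(n : ℝ) ^ (δ' / δ)⌋₊ : ℝ) ^ δ ∧
      D ⌊(n : ℝ) ^ (δ' / δ)⌋₊ ≤ n ∧
      2 * n * (2 * (D ⌊(n : ℝ) ^ (δ' / δ)⌋₊ / 2) + 1) ≤ ⌊(n : ℝ) ^ (δ' / δ)⌋₊ := by
  set γ := δ' / δ with hγ
  have hγ1 : 1 < γ := by rw [hγ, lt_div_iff₀ hδ]; linarith
  have hN : Tendsto (fun n : ℕ => ⌊(n : ℝ) ^ γ⌋₊) atTop atTop :=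
    tendsto_nat_floor_atTop.comp
      ((tendsto_rpow_atTop (by linarith)).comp tendsto_natCast_atTop_atTop)
  refine ⟨hN, ?_⟩
  have hη : 0 < (γ - 1) / 2 := by linarith
  have hx : Tendsto (fun n : ℕ => (n : ℝ) ^ ((γ - 1) / 2)) atTop atTop :=
    (tendsto_rpow_atTop hη).comp tendsto_natCast_atTop_atTop
  have hNδ : Tendsto (fun n : ℕ => (⌊(n : ℝ) ^ γ⌋₊ : ℝ) ^ δ) atTop atTop :=
    (tendsto_rpow_atTop hδ).comp (tendsto_natCast_atTop_atTop.comp hN)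
  filter_upwards [eventually_ge_atTop 1, hx.eventually_ge_atTop 3,
    hNδ.eventually_ge_atTop (7 / C), hN.eventually (hD (1 / γ) (by positivity)),
    hN.eventually (hD ((γ - 1) / 2 / γ) (by positivity))] with n hn hx3 h7 hD1 hD2
  have hnR : (1 : ℝ) ≤ n := by exact_mod_cast hn
  have hn0 : (0 : ℝ) ≤ n := by linarith
  have hfl : (⌊(n : ℝ) ^ γ⌋₊ : ℝ) ≤ (n : ℝ) ^ γ := Nat.floor_le (by positivity)
  have hroot : ∀ ε : ℝ, 0 ≤ ε → (⌊(n : ℝ) ^ γ⌋₊ : ℝ) ^ (ε / γ) ≤ (n : ℝ) ^ ε := by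
    intro ε hε
    calc (⌊(n : ℝ) ^ γ⌋₊ : ℝ) ^ (ε / γ) ≤ ((n : ℝ) ^ γ) ^ (ε / γ) :=
          Real.rpow_le_rpow (Nat.cast_nonneg _) hfl (by positivity)
      _ = (n : ℝ) ^ ε := by
          rw [← Real.rpow_mul hn0, mul_div_cancel₀ _ (by linarith : γ ≠ 0)]
  refine ⟨?_, ?_, ?_, ?_, ?_, ?_⟩
  · apply Nat.le_floor
    calc (n : ℝ) = (n : ℝ) ^ (1 : ℝ) := (Real.rpow_one _).symm
      _ ≤ (n : ℝ) ^ γ := Real.rpow_le_rpow_of_exponent_le hnR hγ1.le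
  · have : (⌊(n : ℝ) ^ γ⌋₊ : ℝ) ≤ (n : ℝ) ^ ⌈γ⌉₊ := by
      refine hfl.trans ?_
      rw [← Real.rpow_natCast]
      exact Real.rpow_le_rpow_of_exponent_le hnR (Nat.le_ceil γ)
    exact_mod_cast this
  · have := hroot δ' (by linarith)
    rwa [hγ, div_div_cancel₀ (by linarith : δ' ≠ 0)] at this
  · rw [div_le_iff₀ hC] at h7
    linarith
  · have h1 := hD1.trans (hroot 1 zero_le_one)
    rw [Real.rpow_one] at h1
    exact_mod_cast h1
  · apply Nat.le_floor
    have h1 := hD2.trans (hroot _ hη.le)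
    set x := (n : ℝ) ^ ((γ - 1) / 2) with hxdef
    have h2 : (n : ℝ) ^ γ = n * x ^ 2 := by
      rw [hxdef, ← Real.rpow_natCast, ← Real.rpow_mul hn0]
      nth_rewrite 2 [← Real.rpow_one (n : ℝ)]
      rw [← Real.rpow_add (by linarith)]
      congr 1
      push_cast
      ring
    have h3 : 2 * (D ⌊(n : ℝ) ^ γ⌋₊ / 2) ≤ D ⌊(n : ℝ) ^ γ⌋₊ := Nat.mul_div_le _ _
    have h4 : ((2 * (D ⌊(n : ℝ) ^ γ⌋₊ / 2) + 1 : ℕ) : ℝ) ≤ x + 1 := by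
      have : ((2 * (D ⌊(n : ℝ) ^ γ⌋₊ / 2) : ℕ) : ℝ) ≤ D ⌊(n : ℝ) ^ γ⌋₊ := by exact_mod_cast h3
      push_cast at this ⊢
      linarith
    have h5 : ((2 * n * (2 * (D ⌊(n : ℝ) ^ γ⌋₊ / 2) + 1) : ℕ) : ℝ) =
        2 * n * ((2 * (D ⌊(n : ℝ) ^ γ⌋₊ / 2) + 1 : ℕ) : ℝ) := by push_cast; ring
    rw [h5]
    refine le_trans ?_ (le_of_eq h2.symm)
    calc 2 * (n : ℝ) * ((2 * (D ⌊(n : ℝ) ^ γ⌋₊ / 2) + 1 : ℕ) : ℝ) ≤ 2 * n * (x + 1) :=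
          mul_le_mul_of_nonneg_left h4 (by positivity)
      _ = n * (2 * (x + 1)) := by ring
      _ ≤ n * x ^ 2 := mul_le_mul_of_nonneg_left (by nlinarith) hn0

/-- With fan-out `⌊n ^ δ⌋`, a constant number of rounds suffices for a broadcast to polynomially
many machines. -/
theorem exists_eventually_pow_le_floor_pow {δ : ℝ} (hδ : 0 < δ) (k : ℕ) :
    ∃ d : ℕ, ∀ᶠ n : ℕ in atTop, 0 < ⌊(n : ℝ) ^ δ⌋₊ ∧ n ^ k ≤ ⌊(n : ℝ) ^ δ⌋₊ ^ d := by
  refine ⟨⌈k / (δ / 2)⌉₊, ?_⟩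
  have hx : Tendsto (fun n : ℕ => (n : ℝ) ^ (δ / 2)) atTop atTop :=
    (tendsto_rpow_atTop (by linarith)).comp tendsto_natCast_atTop_atTop
  filter_upwards [eventually_ge_atTop 1, hx.eventually_ge_atTop 2] with n hn hx2
  have hnR : (1 : ℝ) ≤ n := by exact_mod_cast hn
  have hn0 : (0 : ℝ) < n := by linarith
  have h1 : (n : ℝ) ^ δ = ((n : ℝ) ^ (δ / 2)) ^ 2 := by
    rw [← Real.rpow_natCast, ← Real.rpow_mul hn0.le]
    congr 1
    push_cast
    ring
  have h2 : (n : ℝ) ^ (δ / 2) ≤ ⌊(n : ℝ) ^ δ⌋₊ := by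
    have := Nat.lt_floor_add_one ((n : ℝ) ^ δ)
    nlinarith
  refine ⟨?_, ?_⟩
  · have : (0 : ℝ) < ⌊(n : ℝ) ^ δ⌋₊ := by linarith
    exact_mod_cast this
  · have h3 : ((n ^ k : ℕ) : ℝ) ≤ (⌊(n : ℝ) ^ δ⌋₊ : ℝ) ^ ⌈k / (δ / 2)⌉₊ := by
      calc ((n ^ k : ℕ) : ℝ) = (n : ℝ) ^ (k : ℝ) := by rw [Real.rpow_natCast]; push_cast; rfl
        _ ≤ (n : ℝ) ^ (δ / 2 * ⌈k / (δ / 2)⌉₊) := by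
            apply Real.rpow_le_rpow_of_exponent_le hnR
            have := Nat.le_ceil (k / (δ / 2))
            rwa [div_le_iff₀ (by linarith), mul_comm] at this
        _ = ((n : ℝ) ^ (δ / 2)) ^ ⌈k / (δ / 2)⌉₊ := by
            rw [Real.rpow_mul hn0.le, Real.rpow_natCast]
        _ ≤ _ := pow_le_pow_left₀ (by positivity) h2 _
    exact_mod_cast h3

theorem tendsto_atTop_of_log_isBigO {D : ℕ → ℕ}
    (hD : (fun n : ℕ => Real.log n) =O[atTop] fun n => (D n : ℝ)) : Tendsto D atTop atTop := by
  have hlogn : Tendsto (fun n : ℕ => Real.log n) atTop atTop :=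
    Real.tendsto_log_atTop.comp tendsto_natCast_atTop_atTop
  obtain ⟨c, hc, hb⟩ := hD.exists_pos
  rw [← tendsto_natCast_atTop_iff (R := ℝ)]
  refine tendsto_atTop_mono' _ ?_ (hlogn.const_mul_atTop (inv_pos.2 hc))
  filter_upwards [hb.bound] with n hn
  rw [Real.norm_of_nonneg (Real.log_natCast_nonneg n), Real.norm_of_nonneg (Nat.cast_nonneg _)]
    at hn
  rw [inv_mul_le_iff₀ hc]
  exact hn

/-- The failure probability of the reduction: `P * 2 * n ≤ n ^ 3` simulated executions fail with
probability at most `N ^ (-(c + 3))` each. -/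
theorem reduction_failure_le {n N P c : ℕ} (hn : 2 ≤ n) (hN : n ≤ N) (hP : P ≤ n) :
    (P : ℝ) * (2 * n) * (1 / (N : ℝ) ^ (c + 3)) ≤ 1 / (n : ℝ) ^ c := by
  have hnR : (2 : ℝ) ≤ n := by exact_mod_cast hn
  have hNR : (n : ℝ) ≤ N := by exact_mod_cast hN
  have hPR : (P : ℝ) ≤ n := by exact_mod_cast hP
  have hn0 : (0 : ℝ) < n := by linarith
  have hN0 : (0 : ℝ) < N := by linarith
  have h1 : (P : ℝ) * (2 * n) ≤ (n : ℝ) ^ 3 := by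
    calc (P : ℝ) * (2 * n) ≤ n * (n * n) :=
          mul_le_mul hPR (by nlinarith) (by positivity) (by positivity)
      _ = (n : ℝ) ^ 3 := by ring
  rw [mul_one_div, div_le_div_iff₀ (by positivity) (by positivity), one_mul]
  calc (P : ℝ) * (2 * n) * (n : ℝ) ^ c ≤ (n : ℝ) ^ 3 * (n : ℝ) ^ c :=
        mul_le_mul_of_nonneg_right h1 (by positivity)
    _ = (n : ℝ) ^ (c + 3) := by ring
    _ ≤ (N : ℝ) ^ (c + 3) := pow_le_pow_left₀ (by positivity) hNR _

/-- A fast algorithm for path orientations on forests of small diameter yields a fast algorithm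
that distinguishes one cycle from two. -/
theorem oneVsTwoCycles_lowSpaceSolvable {maxDeg : ℕ} (hmax : 2 ≤ maxDeg) {δ δ' : ℝ} {D : ℕ → ℕ}
    (hδ : 0 < δ) (hδδ' : δ < δ')
    (hDlog : (fun n : ℕ => Real.log n) =O[atTop] fun n => (D n : ℝ))
    (hDpow : ∀ ε : ℝ, 0 < ε → ∀ᶠ n : ℕ in atTop, (D n : ℝ) ≤ (n : ℝ) ^ ε)
    (hsolve : ((pathOrientation maxDeg).onForests D).LowSpaceSolvable δ
      fun n => Real.log (D n)) :
    oneVsTwoCycles.LowSpaceSolvable δ' fun n => Real.log n := by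
  intro c
  obtain ⟨k, hk, C, hC, T, hT, A, hA⟩ := hsolve (c + 3)
  have hDtop := tendsto_atTop_of_log_isBigO hDlog
  obtain ⟨hN, hbounds⟩ := eventually_reduction_bounds hδ hδδ' hC hDpow
  set N : ℕ → ℕ := fun n => ⌊(n : ℝ) ^ (δ' / δ)⌋₊ with hNdef
  obtain ⟨d, hd⟩ := exists_eventually_pow_le_floor_pow (hδ.trans hδδ') (2 + ⌈δ' / δ⌉₊ * k)
  refine ⟨2 + ⌈δ' / δ⌉₊ * k, by omega, C + 10, by linarith,
    fun n => 3 + d + (Nat.log (D (N n) / 2) n + 1) * (T (N n) + 2 + d) + d,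
    reduction_rounds_isLittleO hN hT hDtop (hbounds.mono fun n h => h.2.2.2.2.1) d, ?_⟩
  -- it suffices to find a program for every large `n`
  let Works : ∀ n, MPCProgram n (n ^ (2 + ⌈δ' / δ⌉₊ * k)) Unit Prop → Prop := fun n B =>
    ∀ (G : SimpleGraph (Fin n)) (gin : HalfEdgeLabeling G Unit),
      IsOneCycle G ∨ IsTwoCycles G → ∀ host : Fin n → Fin (n ^ (2 + ⌈δ' / δ⌉₊ * k)),
        (∀ i, ((localInput gin host i).size : ℝ) ≤ (C + 10) * (n : ℝ) ^ δ') →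
        1 - 1 / (n : ℝ) ^ c ≤ B.successProb (localInput gin host)
          (3 + d + (Nat.log (D (N n) / 2) n + 1) * (T (N n) + 2 + d) + d)
          ((C + 10) * (n : ℝ) ^ δ') fun res => ∀ i, res i ↔ IsOneCycle G
  suffices h : ∀ᶠ n : ℕ in atTop, ∃ B, Works n B by
    have hne : ∀ n, Nonempty (MPCProgram n (n ^ (2 + ⌈δ' / δ⌉₊ * k)) Unit Prop) := fun n =>
      ⟨.ofRounds Unit inferInstance inferInstance (fun _ _ => []) (fun _ => []) fun _ _ => True⟩
    exact ⟨fun n => @Classical.epsilon _ (hne n) (Works n), h.mono fun n hn =>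
      Classical.epsilon_spec hn⟩
  filter_upwards [hbounds, hd, hN.eventually hA, (hDtop.comp hN).eventually_ge_atTop 4,
    eventually_ge_atTop 2] with n hn hdn hAn hD4 hn2
  obtain ⟨hnN, hNpow, hNδ, h7, hDn, hcode⟩ := hn
  obtain ⟨hB, hM⟩ := hdn
  change n ≤ N n at hnN
  change N n ≤ n ^ _ at hNpow
  change (N n : ℝ) ^ δ ≤ _ at hNδ
  change 7 ≤ C * (N n : ℝ) ^ δ at h7
  change 2 * n * (2 * (D (N n) / 2) + 1) ≤ N n at hcode
  change 4 ≤ D (N n) at hD4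
  have hNK : N n ≤ N n ^ k := Nat.le_self_pow (by omega) _
  have hKM : 2 * n * N n ^ k ≤ n ^ (2 + ⌈δ' / δ⌉₊ * k) := by
    rw [pow_add, pow_mul]
    refine Nat.mul_le_mul ?_ (Nat.pow_le_pow_left hNpow k)
    rw [sq]
    exact Nat.mul_le_mul_right n hn2
  obtain ⟨Λ⟩ := SimLayout.nonempty_of_le (by omega) hcode hNK hKM
  obtain ⟨pair⟩ : Nonempty (Fin n × Fin n ↪ Fin (n ^ (2 + ⌈δ' / δ⌉₊ * k))) :=
    Function.Embedding.nonempty_of_card_le (by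
      rw [Fintype.card_prod, Fintype.card_fin, Fintype.card_fin, ← sq]
      exact Nat.pow_le_pow_right (by omega) (by omega))
  have hx1 : (1 : ℝ) ≤ (n : ℝ) ^ δ' :=
    Real.one_le_rpow (by exact_mod_cast (by omega : 1 ≤ n)) (by linarith)
  have hSA : 4 + ⌊C * (N n : ℝ) ^ δ⌋₊ ≤ ⌊(C + 10) * (n : ℝ) ^ δ'⌋₊ := by
    apply Nat.le_floor
    have h1 : (⌊C * (N n : ℝ) ^ δ⌋₊ : ℝ) ≤ C * (N n : ℝ) ^ δ := Nat.floor_le (by positivity)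
    have h2 := mul_le_mul_of_nonneg_left hNδ hC.le
    push_cast
    linarith
  have hBS : ⌊(n : ℝ) ^ δ'⌋₊ * 6 ≤ ⌊(C + 10) * (n : ℝ) ^ δ'⌋₊ := by
    apply Nat.le_floor
    have h1 : (⌊(n : ℝ) ^ δ'⌋₊ : ℝ) ≤ (n : ℝ) ^ δ' := Nat.floor_le (by positivity)
    have h2 : 0 ≤ C * (n : ℝ) ^ δ' := by positivity
    push_cast
    linarith
  have hl : 1 < D (N n) / 2 := by omega
  obtain ⟨B, hBspec⟩ := exists_cycles_program (k := maxDeg) (p := 1 / (N n : ℝ) ^ (c + 3)) Λ pair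
    (A (N n)) (fun G gin hac hdeg hdiam host hsize => hAn G gin
      ⟨hac, fun v => (hdeg v).trans hmax, fun u v huv => (hdiam u v huv).trans (Nat.mul_div_le _ _)⟩
      host fun i => le_trans (by exact_mod_cast hsize i) h7)
    (by omega) (Nat.lt_pow_succ_log_self hl n) hSA hB hBS (Nat.floor_le (by positivity)) hM
  refine ⟨B, fun G gin hcyc host hsize => ?_⟩
  refine le_trans ?_ (hBspec G gin hcyc host fun i => Nat.le_floor (hsize i))
  have hP : Nat.log (D (N n) / 2) n + 1 ≤ n := Nat.log_lt_self _ (by omega)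
  linarith [reduction_failure_le (c := c) hn2 hnN hP]

theorem mainTheorem5 (hconj : OneVsTwoCyclesConjecture) :
    -- no low-space algorithms for all solvable LCLs in `o(log D)` rounds on forests
    (∀ (δ : ℝ) (D : ℕ → ℕ), 0 < δ → δ < 1 →
      (fun n : ℕ => Real.log n) =O[atTop] (fun n => (D n : ℝ)) →
      (∀ ε : ℝ, 0 < ε → ∀ᶠ n : ℕ in atTop, (D n : ℝ) ≤ (n : ℝ) ^ ε) →
      ¬ ∀ P : LCL, P.SolvableOnForests →
        (P.onForests D).LowSpaceSolvable δ (fun n => Real.log (D n))) ∧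
    -- a single problem that witnesses this, for all `δ` and `D`
    ∀ maxDeg : ℕ, 2 ≤ maxDeg →
      (pathOrientation maxDeg).SolvableOnForests ∧
      -- its solutions reveal, at `t`, whether `s` and `t` are on the same path
      (∀ (n : ℕ) (G : SimpleGraph (Fin n)), G.IsAcyclic → MaxDegreeLE G 2 →
        ∀ s t : Fin n, s ≠ t → (G.neighborSet s).ncard = 1 → (G.neighborSet t).ncard = 1 →
        ∀ (gin : HalfEdgeLabeling G Bool) (gout : HalfEdgeLabeling G EdgeStatus),
          (∀ d : G.Dart, gin d = true ↔ d.fst = s) →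
          (pathOrientation maxDeg).IsSolution gin gout →
          ∀ d : G.Dart, d.fst = t →
            (G.Reachable s t ↔ gout d ≠ EdgeStatus.unoriented)) ∧
      ∀ (δ : ℝ) (D : ℕ → ℕ), 0 < δ → δ < 1 →
        (fun n : ℕ => Real.log n) =O[atTop] (fun n => (D n : ℝ)) →
        (∀ ε : ℝ, 0 < ε → ∀ᶠ n : ℕ in atTop, (D n : ℝ) ≤ (n : ℝ) ^ ε) →
        ¬ ((pathOrientation maxDeg).onForests D).LowSpaceSolvable δ
          (fun n => Real.log (D n)) := by
  have hhard : ∀ maxDeg : ℕ, 2 ≤ maxDeg → ∀ (δ : ℝ) (D : ℕ → ℕ), 0 < δ → δ < 1 →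
      (fun n : ℕ => Real.log n) =O[atTop] (fun n => (D n : ℝ)) →
      (∀ ε : ℝ, 0 < ε → ∀ᶠ n : ℕ in atTop, (D n : ℝ) ≤ (n : ℝ) ^ ε) →
      ¬ ((pathOrientation maxDeg).onForests D).LowSpaceSolvable δ
        (fun n => Real.log (D n)) := fun maxDeg hmax δ D hδ hδ1 hD hD' h =>
    hconj ((δ + 1) / 2) (by linarith) (by linarith)
      (oneVsTwoCycles_lowSpaceSolvable hmax hδ (by linarith) hD hD' h)
  refine ⟨fun δ D hδ hδ1 hD hD' h => hhard 2 le_rfl δ D hδ hδ1 hD hD'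
    (h _ (pathOrientation_solvableOnForests 2)), fun maxDeg hmax =>
    ⟨pathOrientation_solvableOnForests maxDeg, ?_, hhard maxDeg hmax⟩⟩
  intro n G hG hdeg s t hst hs ht gin gout hgin hsol d hd
  exact pathOrientation_reveals hsol hG hdeg hst hs ht hgin hd
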